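/- **Theorem 6.3.** A function $h\colon\{0,1\}^n\to\{-1,+1\}$ is a *halfspace* if there are reals $a_1,\dots,a_n,\theta$ such that $h(x)=\operatorname{sign}(a_1x_1+\cdots+a_nx_n-\theta)$ for all $x\in\{0,1\}^n$, where $\operatorname{sign}t=-1,0,1$ for $t<0$, $t=0$, $t>0$, respectively. Regard $-1$ as "true" and $+1$ as "false". Let $\mathrm{MAJ}_n\colon\{0,1\}^n\to\{-1,+1\}$ be given by $\mathrm{MAJ}_n(x)=-1$ if $x_1+\cdots+x_n>n/2$ and $\mathrm{MAJ}_n(x)=1$ otherwise. For $f,g\colon\{0,1\}^n\to\{-1,+1\}$, let $f\wedge g\colon\{0,1\}^n\times\{0,1\}^n\to\{-1,+1\}$ be the function with $(f\wedge g)(x,y)=-1$ if $f(x)=g(y)=-1$, and $(f\wedge g)(x,y)=1$ otherwise. For $F\colon\{0,1\}^N\to\{-1,+1\}$, let the *threshold degree* $\deg_\pm(F)$ be the least total degree of a real polynomial $p$ in $N$ variables with $F(z)=\operatorname{sign}p(z)$ for all $z\in\{0,1\}^N$. Then there is a family of halfspaces $h_n\colon\{0,1\}^n\to\{-1,+1\}$,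 $n=1,2,3,\dots$, such that $$\deg_\pm(h_n\wedge \mathrm{MAJ}_n)=\Theta\bigl(\sqrt{n\log_2 n}\bigr)\qquad(n\to\infty),$$ that is, there are constants $c,C>0$ with $c\sqrt{n\log_2 n}\le\deg_\pm(h_n\wedge\mathrm{MAJ}_n)\le C\sqrt{n\log_2 n}$ for all sufficiently large $n$. -/

import Mathlib

open Filter Asymptotics

/-- The real vector in `{0,1}^σ` that a Boolean vector stands for. -/
def cubePoint {σ : Type*} (x : σ → Bool) : σ → ℝ := fun i => if x i then 1 else 0

/-- `h : {0,1}^n → {-1,+1}` is a halfspace: `h(x) = sign(∑ aᵢ xᵢ - θ)` for some reals `aᵢ, θ`.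
Here `{-1,+1}` is `ℤˣ`, and since `sign 0 = 0`, the linear form never vanishes on the cube. -/
def IsHalfspace {n : ℕ} (h : (Fin n → Bool) → ℤˣ) : Prop :=
  ∃ (a : Fin n → ℝ) (θ : ℝ), ∀ x : Fin n → Bool,
    (((h x : ℤˣ) : ℤ) : ℝ) = Real.sign (∑ i, a i * cubePoint x i - θ)

/-- The majority function on `{0,1}^n`: `-1` (true) if `x₁ + ⋯ + xₙ > n / 2`, and `1` otherwise. -/
noncomputable def majority (n : ℕ) (x : Fin n → Bool) : ℤˣ :=
  open Classical in if (n : ℝ) / 2 < ∑ i, cubePoint x i then -1 else 1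

/-- The conjunction `(f ∧ g)(x, y) = f(x) ∧ g(y)` of two Boolean functions on disjoint sets of
variables, where `-1` is "true" and `1` is "false". -/
def conjunction {σ τ : Type*} (f : (σ → Bool) → ℤˣ) (g : (τ → Bool) → ℤˣ) :
    (σ ⊕ τ → Bool) → ℤˣ := fun z =>
  if f (fun i => z (Sum.inl i)) = -1 ∧ g (fun j => z (Sum.inr j)) = -1 then -1 else 1

/-- The threshold degree of `f : {0,1}^σ → {-1,+1}`: the least total degree of a real polynomial
`p` with `f(x) = sign p(x)` on the whole cube.  (For finite `σ`, every `f` is a polynomial on the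
cube, so the set is nonempty.) -/
noncomputable def thresholdDegree {σ : Type*} (f : (σ → Bool) → ℤˣ) : ℕ :=
  sInf {d : ℕ | ∃ p : MvPolynomial σ ℝ, p.totalDegree = d ∧
    ∀ x : σ → Bool, (((f x : ℤˣ) : ℤ) : ℝ) = Real.sign (MvPolynomial.eval (cubePoint x) p)}

/-!
Suppose that a polynomial of degree `d` represents the sign of `f ∧ g`. Ville's theorem of the
alternative, applied to its absolute values weighted by the signs, produces either a rational
approximation of `f` or a rational function that separates the values of `g`, both of degree `O(d)`
and with reciprocal qualities. So it suffices to find a halfspace without rational approximations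
and to see that the majority function has no good rational separation.

Both obstructions rest on the complex roots of univariate polynomials. Near a point of a geometric
progression that has few roots around it, numerator and denominator behave like monomials, so their
quotient cannot approximate the sign function at the points `±B ^ j` for `j ≤ J` unless the degree
is of order `J`. Likewise a polynomial of degree `d` cannot be much larger at all
integers in `[2 ^ i, 2 ^ (i + J)]` than at their negatives; by Minsky–Papert symmetrization this
bounds the quality of a rational separation of the majority function.

For the halfspace, the fibres of a random subset sum modulo `M` are so uniform that they carry
distributions with equal moments up to degree `d`. Absorbing the multiples of `M` into a second
block of variables yields an integer linear form through which every polynomial on the cube turns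
into a univariate one on `0, …, M - 1`, with `M` exponential in `n / d`. Fixing the variables of the
halfspace one at a time lowers the threshold degree of the conjunction by at most one per step, so
that every intermediate degree is attained, and one of order `√(n log n)` can be prescribed.
-/

/-! ### Functions of low degree on the cube -/

/-- The multilinear monomial `∏ i ∈ S, x i` on the cube. -/
def cubeMonomial {σ : Type*} (S : Finset σ) (x : σ → Bool) : ℝ := ∏ i ∈ S, cubePoint x i

/-- The space of functions on the cube that are given by polynomials of degree at most `d`. Only
multilinear monomials are needed to span it, because `x i ^ 2 = x i` on the cube. -/
def lowDegree (σ : Type*) (d : ℕ) : Submodule ℝ ((σ → Bool) → ℝ) :=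
  Submodule.span ℝ {f | ∃ S : Finset σ, S.card ≤ d ∧ f = cubeMonomial S}

section LowDegree

variable {σ τ : Type*} {d e : ℕ}

lemma cubePoint_pow (x : σ → Bool) (i : σ) {k : ℕ} (hk : k ≠ 0) :
    cubePoint x i ^ k = cubePoint x i := by
  cases h : x i <;> simp [cubePoint, h, hk]

lemma cubeMonomial_eq_ite (S : Finset σ) (x : σ → Bool) :
    cubeMonomial S x = if ∀ i ∈ S, x i = true then 1 else 0 :=
  Finset.prod_ite_zero.trans (by simp)

lemma cubeMonomial_mul [DecidableEq σ] (S T : Finset σ) :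
    cubeMonomial S * cubeMonomial T = cubeMonomial (S ∪ T) := by
  funext x
  simp only [Pi.mul_apply, cubeMonomial_eq_ite, Finset.forall_mem_union, ite_and, ite_mul, one_mul,
    zero_mul]

lemma cubeMonomial_mem_lowDegree {S : Finset σ} (h : S.card ≤ d) :
    cubeMonomial S ∈ lowDegree σ d :=
  Submodule.subset_span ⟨S, h, rfl⟩

lemma lowDegree_mono (h : d ≤ e) : lowDegree σ d ≤ lowDegree σ e :=
  Submodule.span_mono fun _ ⟨S, hS, hf⟩ => ⟨S, hS.trans h, hf⟩

lemma const_mem_lowDegree (c : ℝ) : (fun _ : σ → Bool => c) ∈ lowDegree σ d := by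
  convert Submodule.smul_mem _ c (cubeMonomial_mem_lowDegree (S := (∅ : Finset σ)) (Nat.zero_le d))
  simp [cubeMonomial]

lemma cubePoint_mem_lowDegree (i : σ) : (fun x => cubePoint x i) ∈ lowDegree σ 1 := by
  convert cubeMonomial_mem_lowDegree (Finset.card_singleton i).le
  simp [cubeMonomial]

lemma mul_mem_lowDegree {f g : (σ → Bool) → ℝ} (hf : f ∈ lowDegree σ d)
    (hg : g ∈ lowDegree σ e) : f * g ∈ lowDegree σ (d + e) := by
  classical
  suffices h : lowDegree σ d * lowDegree σ e ≤ lowDegree σ (d + e) from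
    h (Submodule.mul_mem_mul hf hg)
  rw [lowDegree, lowDegree, Submodule.span_mul_span]
  refine Submodule.span_mono ?_
  rintro _ ⟨_, ⟨S, hS, rfl⟩, _, ⟨T, hT, rfl⟩, rfl⟩
  exact ⟨S ∪ T, (Finset.card_union_le _ _).trans (add_le_add hS hT), cubeMonomial_mul S T⟩

lemma prod_mem_lowDegree {ι : Type*} (S : Finset ι) {f : ι → (σ → Bool) → ℝ}
    (hf : ∀ i ∈ S, f i ∈ lowDegree σ d) : ∏ i ∈ S, f i ∈ lowDegree σ (S.card * d) := by
  classical
  induction S using Finset.induction_on with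
  | empty => exact const_mem_lowDegree 1
  | insert i S hi ih =>
    rw [Finset.prod_insert hi, Finset.card_insert_of_notMem hi, add_one_mul, add_comm]
    exact mul_mem_lowDegree (hf i (Finset.mem_insert_self i S))
      (ih fun j hj => hf j (Finset.mem_insert_of_mem hj))

lemma polynomial_eval_comp_mem_lowDegree {f : (σ → Bool) → ℝ} (hf : f ∈ lowDegree σ e)
    {p : Polynomial ℝ} (hp : p.natDegree ≤ d) : (fun x => p.eval (f x)) ∈ lowDegree σ (d * e) := by
  have hsum : (fun x => p.eval (f x)) =
      ∑ k ∈ Finset.range (p.natDegree + 1), p.coeff k • ∏ _i ∈ Finset.range k, f := by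
    funext x
    simp [Polynomial.eval_eq_sum_range]
  rw [hsum]
  refine Submodule.sum_mem _ fun k hk => Submodule.smul_mem _ _ ?_
  refine lowDegree_mono ?_ (prod_mem_lowDegree _ fun _ _ => hf)
  rw [Finset.card_range]
  exact Nat.mul_le_mul_right e ((Finset.mem_range_succ_iff.1 hk).trans hp)

lemma mvPolynomial_eval_mem_lowDegree {p : MvPolynomial σ ℝ} (hp : p.totalDegree ≤ d) :
    (fun x => MvPolynomial.eval (cubePoint x) p) ∈ lowDegree σ d := by
  have hsum : (fun x => MvPolynomial.eval (cubePoint x) p) =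
      ∑ m ∈ p.support, p.coeff m • (cubeMonomial m.support : (σ → Bool) → ℝ) := by
    funext x
    simp only [MvPolynomial.eval_eq, Finset.sum_apply, Pi.smul_apply, smul_eq_mul, cubeMonomial]
    refine Finset.sum_congr rfl fun m _ => congrArg _ (Finset.prod_congr rfl fun i hi => ?_)
    exact cubePoint_pow x i (Finsupp.mem_support_iff.1 hi)
  rw [hsum]
  refine Submodule.sum_mem _ fun m hm => Submodule.smul_mem _ _ (cubeMonomial_mem_lowDegree ?_)
  calc m.support.card = ∑ _i ∈ m.support, 1 := Finset.card_eq_sum_ones _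
    _ ≤ m.sum fun _ k => k := Finset.sum_le_sum fun i hi =>
      Nat.one_le_iff_ne_zero.2 (Finsupp.mem_support_iff.1 hi)
    _ ≤ d := (MvPolynomial.le_totalDegree hm).trans hp

lemma exists_mvPolynomial_of_mem_lowDegree {f : (σ → Bool) → ℝ} (hf : f ∈ lowDegree σ d) :
    ∃ p : MvPolynomial σ ℝ, p.totalDegree ≤ d ∧ ∀ x, f x = MvPolynomial.eval (cubePoint x) p := by
  induction hf using Submodule.span_induction with
  | mem f hf =>
    obtain ⟨S, hS, rfl⟩ := hf
    refine ⟨∏ i ∈ S, MvPolynomial.X i, ?_, fun x => by simp [cubeMonomial]⟩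
    exact (MvPolynomial.totalDegree_finsetProd S _).trans (by simpa using hS)
  | zero => exact ⟨0, by simp, by simp⟩
  | add f g _ _ hf hg =>
    obtain ⟨p, hp, hpe⟩ := hf
    obtain ⟨q, hq, hqe⟩ := hg
    exact ⟨p + q, (MvPolynomial.totalDegree_add p q).trans (max_le hp hq),
      fun x => by simp [hpe, hqe]⟩
  | smul a f _ hf =>
    obtain ⟨p, hp, hpe⟩ := hf
    exact ⟨a • p, (MvPolynomial.totalDegree_smul_le a p).trans hp, fun x => by simp [hpe]⟩

lemma comp_mem_lowDegree {f : (σ → Bool) → ℝ} (hf : f ∈ lowDegree σ d)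
    {u : (τ → Bool) → σ → Bool} (hu : ∀ i, (fun y => cubePoint (u y) i) ∈ lowDegree τ 1) :
    (fun y => f (u y)) ∈ lowDegree τ d := by
  induction hf using Submodule.span_induction with
  | mem f hf =>
    obtain ⟨S, hS, rfl⟩ := hf
    have hprod : (fun y => cubeMonomial S (u y)) = ∏ i ∈ S, fun y => cubePoint (u y) i := by
      funext y
      simp [cubeMonomial]
    rw [hprod]
    exact lowDegree_mono (by rwa [mul_one]) (prod_mem_lowDegree S fun i _ => hu i)
  | zero => exact Submodule.zero_mem _
  | add f g _ _ hf hg => exact Submodule.add_mem _ hf hg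
  | smul a f _ hf => exact Submodule.smul_mem _ a hf

lemma elim_left_mem_lowDegree {φ : (σ ⊕ τ → Bool) → ℝ} (hφ : φ ∈ lowDegree (σ ⊕ τ) d)
    (y : τ → Bool) : (fun x => φ (Sum.elim x y)) ∈ lowDegree σ d :=
  comp_mem_lowDegree hφ <| by
    rintro (i | j)
    · exact cubePoint_mem_lowDegree i
    · exact const_mem_lowDegree (cubePoint y j)

lemma elim_right_mem_lowDegree {φ : (σ ⊕ τ → Bool) → ℝ} (hφ : φ ∈ lowDegree (σ ⊕ τ) d)
    (x : σ → Bool) : (fun y => φ (Sum.elim x y)) ∈ lowDegree τ d :=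
  comp_mem_lowDegree hφ <| by
    rintro (i | j)
    · exact const_mem_lowDegree (cubePoint x i)
    · exact cubePoint_mem_lowDegree j

lemma boole_coord_eq_mem_lowDegree (i : σ) (b : Bool) :
    (fun x : σ → Bool => if x i = b then (1 : ℝ) else 0) ∈ lowDegree σ 1 := by
  cases b with
  | true => exact cubePoint_mem_lowDegree i
  | false =>
    convert Submodule.sub_mem _ (const_mem_lowDegree 1) (cubePoint_mem_lowDegree i) using 1
    funext x
    cases hx : x i <;> simp [cubePoint, hx]

lemma mem_lowDegree_card [Fintype σ] (f : (σ → Bool) → ℝ) : f ∈ lowDegree σ (Fintype.card σ) := by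
  classical
  have hsum : f = ∑ a, f a • ∏ i, fun x => if x i = a i then (1 : ℝ) else 0 := by
    funext x
    simp [Finset.prod_ite_zero, ← funext_iff]
  rw [hsum]
  refine Submodule.sum_mem _ fun a _ => Submodule.smul_mem _ _ ?_
  simpa using prod_mem_lowDegree Finset.univ fun i _ => boole_coord_eq_mem_lowDegree i (a i)

end LowDegree

/-! ### Sign representations -/

/-- `f` sign-represents `F`: it is nowhere zero and has the sign of `F`. -/
def SignRepresents {σ : Type*} (f : (σ → Bool) → ℝ) (F : (σ → Bool) → ℤˣ) : Prop :=
  ∀ x, 0 < ((F x : ℤ) : ℝ) * f x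

section SignRepresents

variable {σ τ : Type*} {d : ℕ}

lemma units_eq_sign_iff (u : ℤˣ) (r : ℝ) :
    ((u : ℤ) : ℝ) = Real.sign r ↔ 0 < ((u : ℤ) : ℝ) * r := by
  have hsign := Real.sign_mul_pos_of_ne_zero r
  constructor
  · intro h
    have hr : r ≠ 0 := by rintro rfl; simp at h
    exact h ▸ hsign hr
  · intro h
    have hr : 0 < Real.sign r * r := hsign (right_ne_zero_of_mul h.ne')
    rcases Int.units_eq_one_or u with rfl | rfl <;>
      rcases Real.sign_apply_eq_of_ne_zero r (right_ne_zero_of_mul h.ne') with hs | hs <;>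
      rw [hs] at hr ⊢ <;> push_cast at h ⊢ <;> linarith

lemma thresholdDegree_le_iff [Finite σ] {F : (σ → Bool) → ℤˣ} :
    thresholdDegree F ≤ d ↔ ∃ f ∈ lowDegree σ d, SignRepresents f F := by
  have := Fintype.ofFinite σ
  constructor
  · intro h
    have hne : {d : ℕ | ∃ p : MvPolynomial σ ℝ, p.totalDegree = d ∧ ∀ x : σ → Bool,
        (((F x : ℤˣ) : ℤ) : ℝ) = Real.sign (MvPolynomial.eval (cubePoint x) p)}.Nonempty := by
      obtain ⟨p, -, hp⟩ := exists_mvPolynomial_of_mem_lowDegree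
        (mem_lowDegree_card fun x => (((F x : ℤˣ) : ℤ) : ℝ))
      refine ⟨_, p, rfl, fun x => ?_⟩
      rw [units_eq_sign_iff, ← hp]
      exact mul_self_pos.2 (by simp)
    obtain ⟨p, hp, hs⟩ := Nat.sInf_mem hne
    exact ⟨_, mvPolynomial_eval_mem_lowDegree (hp.trans_le h),
      fun x => (units_eq_sign_iff _ _).1 (hs x)⟩
  · rintro ⟨f, hf, hs⟩
    obtain ⟨p, hp, hpe⟩ := exists_mvPolynomial_of_mem_lowDegree hf
    refine le_trans (Nat.sInf_le ⟨p, rfl, fun x => ?_⟩) hp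
    rw [units_eq_sign_iff, ← hpe]
    exact hs x

lemma conjunction_elim (f : (σ → Bool) → ℤˣ) (g : (τ → Bool) → ℤˣ) (x : σ → Bool)
    (y : τ → Bool) :
    conjunction f g (Sum.elim x y) = if f x = -1 ∧ g y = -1 then -1 else 1 := rfl

lemma SignRepresents.abs_eq {φ : (σ → Bool) → ℝ} {F : (σ → Bool) → ℤˣ}
    (h : SignRepresents φ F) (x : σ → Bool) : |φ x| = ((F x : ℤ) : ℝ) * φ x := by
  have hx := h x
  rcases Int.units_eq_one_or (F x) with hF | hF <;> rw [hF] at hx ⊢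
  · simpa using hx.le
  · simpa using hx.le

lemma SignRepresents.ne_zero {φ : (σ → Bool) → ℝ} {F : (σ → Bool) → ℤˣ}
    (h : SignRepresents φ F) (x : σ → Bool) : φ x ≠ 0 :=
  right_ne_zero_of_mul (h x).ne'

end SignRepresents

/-! ### The theorem of the alternative for conjunctions -/

/-- Ville's theorem of the alternative. -/
theorem exists_mem_stdSimplex_nonneg_or_neg {I J : Type*} [Fintype I] [Fintype J] [Nonempty I]
    [Nonempty J] (A : I → J → ℝ) :
    (∃ w ∈ stdSimplex ℝ J, ∀ i, 0 ≤ ∑ j, w j * A i j) ∨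
      ∃ u ∈ stdSimplex ℝ I, ∀ j, ∑ i, u i * A i j < 0 := by
  classical
  let payoff (u : I → ℝ) (w : J → ℝ) : ℝ := ∑ i, ∑ j, u i * w j * A i j
  have hu_lin (w : J → ℝ) : IsLinearMap ℝ (payoff · w) :=
    ⟨fun u v => by simp [payoff, add_mul, Finset.sum_add_distrib],
      fun c u => by simp [payoff, Finset.mul_sum, mul_assoc]⟩
  have hw_lin (u : I → ℝ) : IsLinearMap ℝ (payoff u) :=
    ⟨fun v w => by simp [payoff, mul_add, add_mul, Finset.sum_add_distrib],
      fun c w => by simp [payoff, Finset.mul_sum, mul_assoc, mul_left_comm]⟩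
  have hI : (stdSimplex ℝ I).Nonempty := ⟨_, single_mem_stdSimplex ℝ (Classical.arbitrary I)⟩
  have hJ : (stdSimplex ℝ J).Nonempty := ⟨_, single_mem_stdSimplex ℝ (Classical.arbitrary J)⟩
  obtain ⟨u, hu, w, hw, hsaddle⟩ := Sion.exists_isSaddlePointOn (f := payoff) hI
    (convex_stdSimplex ℝ I) (isCompact_stdSimplex ℝ I)
    (fun w _ => (Continuous.lowerSemicontinuous (by fun_prop)).lowerSemicontinuousOn _)
    (fun w _ => ((hu_lin w).mk'.convexOn (convex_stdSimplex ℝ I)).quasiconvexOn)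
    (convex_stdSimplex ℝ J) hJ (isCompact_stdSimplex ℝ J)
    (fun u _ => (Continuous.upperSemicontinuous (by fun_prop)).upperSemicontinuousOn _)
    (fun u _ => ((hw_lin u).mk'.concaveOn (convex_stdSimplex ℝ J)).quasiconcaveOn)
  rcases le_or_gt 0 (payoff u w) with h | h
  · refine Or.inl ⟨w, hw, fun i => h.trans ?_⟩
    simpa [payoff, Pi.single_apply] using hsaddle _ (single_mem_stdSimplex ℝ i) w hw
  · refine Or.inr ⟨u, hu, fun j => lt_of_le_of_lt ?_ h⟩
    simpa [payoff, Pi.single_apply] using hsaddle u hu _ (single_mem_stdSimplex ℝ j)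

/-- `f` has a rational approximation `p / q` of degree `d` whose quality is measured by `a`: the
quotient `p / q` has the sign of `f` and absolute value in `[a, 1]`. -/
def HasRationalApprox {σ : Type*} (d : ℕ) (a : ℝ) (f : (σ → Bool) → ℤˣ) : Prop :=
  ∃ p ∈ lowDegree σ d, ∃ q ∈ lowDegree σ d,
    ∀ x, 0 < q x ∧ a * q x ≤ ((f x : ℤ) : ℝ) * p x ∧ ((f x : ℤ) : ℝ) * p x ≤ q x

/-- The values of `g` are separated by a nonnegative rational function `P / Q` of degree `d`, which
is less than `ε` on `g⁻¹(1)` and greater than `1` (possibly infinite) on `g⁻¹(-1)`. -/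
def HasRationalSeparation {τ : Type*} (d : ℕ) (ε : ℝ) (g : (τ → Bool) → ℤˣ) : Prop :=
  ∃ P ∈ lowDegree τ d, ∃ Q ∈ lowDegree τ d, (∀ y, 0 ≤ P y ∧ 0 ≤ Q y) ∧
    (∀ y, g y = 1 → P y < ε * Q y) ∧ ∀ y, g y = -1 → Q y < P y

section Conjunction

variable {σ τ : Type*} {d : ℕ} {f : (σ → Bool) → ℤˣ} {g : (τ → Bool) → ℤˣ}
  {φ : (σ ⊕ τ → Bool) → ℝ}

lemma SignRepresents.abs_eq_of_right_false (h : SignRepresents φ (conjunction f g))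
    (x : σ → Bool) {y : τ → Bool} (hy : g y = 1) : |φ (Sum.elim x y)| = φ (Sum.elim x y) := by
  simp [h.abs_eq, conjunction_elim, hy, show (1 : ℤˣ) ≠ -1 by decide]

lemma SignRepresents.abs_eq_of_right_true (h : SignRepresents φ (conjunction f g))
    (x : σ → Bool) {y : τ → Bool} (hy : g y = -1) :
    |φ (Sum.elim x y)| = ((f x : ℤ) : ℝ) * φ (Sum.elim x y) := by
  rw [h.abs_eq, conjunction_elim]
  rcases Int.units_eq_one_or (f x) with hf | hf <;>
    simp [hf, hy, show (1 : ℤˣ) ≠ -1 by decide]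

lemma hasRationalApprox_of_weights [Fintype τ] [DecidableEq τ] {a : ℝ}
    (hφ : φ ∈ lowDegree (σ ⊕ τ) d) (hs : SignRepresents φ (conjunction f g))
    {w : (τ → Bool) → ℝ} (hw : w ∈ stdSimplex ℝ (τ → Bool))
    (hlow : ∀ x, a * (∑ y with g y ≠ -1, w y * |φ (Sum.elim x y)|) ≤
      ∑ y with g y = -1, w y * |φ (Sum.elim x y)|)
    (hupp : ∀ x, ∑ y with g y = -1, w y * |φ (Sum.elim x y)| ≤
      ∑ y with g y ≠ -1, w y * |φ (Sum.elim x y)|) :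
    HasRationalApprox d a f := by
  have hmem (s : Finset (τ → Bool)) :
      ∑ y ∈ s, w y • (fun x => φ (Sum.elim x y)) ∈ lowDegree σ d :=
    Submodule.sum_mem _ fun y _ => Submodule.smul_mem _ _ (elim_left_mem_lowDegree hφ y)
  refine ⟨_, hmem {y | g y = -1}, _, hmem {y | g y ≠ -1}, fun x => ?_⟩
  have hp : ((f x : ℤ) : ℝ) * (∑ y with g y = -1, w y • fun x => φ (Sum.elim x y)) x =
      ∑ y with g y = -1, w y * |φ (Sum.elim x y)| := by
    rw [Finset.sum_apply, Finset.mul_sum]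
    refine Finset.sum_congr rfl fun y hy => ?_
    rw [hs.abs_eq_of_right_true x (Finset.mem_filter.1 hy).2, Pi.smul_apply, smul_eq_mul,
      mul_left_comm]
  have hq : (∑ y with g y ≠ -1, w y • fun x => φ (Sum.elim x y)) x =
      ∑ y with g y ≠ -1, w y * |φ (Sum.elim x y)| := by
    rw [Finset.sum_apply]
    refine Finset.sum_congr rfl fun y hy => ?_
    have hgy := (Int.units_eq_one_or (g y)).resolve_right (Finset.mem_filter.1 hy).2
    rw [hs.abs_eq_of_right_false x hgy, Pi.smul_apply, smul_eq_mul]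
  have hpos : 0 < ∑ y, w y * |φ (Sum.elim x y)| := by
    obtain ⟨y, -, hy⟩ := Finset.exists_ne_zero_of_sum_ne_zero
      (hw.2.trans_ne (one_ne_zero : (1 : ℝ) ≠ 0))
    refine Finset.sum_pos' (fun y _ => mul_nonneg (hw.1 y) (abs_nonneg _))
      ⟨y, Finset.mem_univ y, mul_pos ((hw.1 y).lt_of_ne' hy) (abs_pos.2 (hs.ne_zero _))⟩
  rw [← Finset.sum_filter_add_sum_filter_not _ (g · = -1)] at hpos
  rw [hp, hq]
  exact ⟨by linarith [hupp x], hlow x, hupp x⟩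

/-- For fixed `y`, the sign of `φ (x, y)` depends only on `f x`. So the sums over the two fibres
of `f` have no cancellation, and the sum of their squares is the required function. -/
lemma exists_lowDegree_comparable_sq_sum_abs [Fintype σ] [DecidableEq σ]
    (hφ : φ ∈ lowDegree (σ ⊕ τ) d) (hs : SignRepresents φ (conjunction f g))
    {u : (σ → Bool) → ℝ} (hu : ∀ x, 0 ≤ u x) :
    ∃ P ∈ lowDegree τ (2 * d), ∀ y, P y ≤ (∑ x, u x * |φ (Sum.elim x y)|) ^ 2 ∧
      (∑ x, u x * |φ (Sum.elim x y)|) ^ 2 ≤ 2 * P y := by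
  let S (c : ℤˣ) (y : τ → Bool) : ℝ := ∑ x with f x = c, u x * φ (Sum.elim x y)
  let T (c : ℤˣ) (y : τ → Bool) : ℝ := ∑ x with f x = c, u x * |φ (Sum.elim x y)|
  have hS (c : ℤˣ) : S c * S c ∈ lowDegree τ (2 * d) := by
    have hmem : S c ∈ lowDegree τ d := by
      have hsum : S c = ∑ x with f x = c, u x • fun y => φ (Sum.elim x y) := by
        funext y
        simp [S]
      rw [hsum]
      exact Submodule.sum_mem _ fun x _ => Submodule.smul_mem _ _ (elim_right_mem_lowDegree hφ x)
    rw [two_mul]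
    exact mul_mem_lowDegree hmem hmem
  have hST (c : ℤˣ) (y : τ → Bool) : T c y ^ 2 = S c y * S c y := by
    obtain ⟨ε, hε⟩ : ∃ ε : ℤˣ, T c y = ((ε : ℤ) : ℝ) * S c y := by
      refine ⟨if c = -1 ∧ g y = -1 then -1 else 1, ?_⟩
      simp only [S, T, Finset.mul_sum]
      refine Finset.sum_congr rfl fun x hx => ?_
      rw [hs.abs_eq, conjunction_elim, (Finset.mem_filter.1 hx).2, mul_left_comm]
    rcases Int.units_eq_one_or ε with rfl | rfl <;> simp [hε, sq]
  have hT0 (c : ℤˣ) (y : τ → Bool) : 0 ≤ T c y :=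
    Finset.sum_nonneg fun x _ => mul_nonneg (hu x) (abs_nonneg _)
  refine ⟨_, Submodule.add_mem _ (hS 1) (hS (-1)), fun y => ?_⟩
  have hsplit : ∑ x, u x * |φ (Sum.elim x y)| = T 1 y + T (-1) y := by
    rw [← Finset.sum_filter_add_sum_filter_not _ (f · = 1)]
    simp only [T, Int.units_ne_iff_eq_neg]
  rw [hsplit, Pi.add_apply, Pi.mul_apply, Pi.mul_apply, ← hST, ← hST]
  exact ⟨by nlinarith [hT0 1 y, hT0 (-1) y], by nlinarith [sq_nonneg (T 1 y - T (-1) y)]⟩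

lemma hasRationalSeparation_of_weights [Fintype σ] [DecidableEq σ] {a : ℝ}
    (hφ : φ ∈ lowDegree (σ ⊕ τ) d) (hs : SignRepresents φ (conjunction f g))
    {u v : (σ → Bool) → ℝ} (hu : ∀ x, 0 ≤ u x) (hv : ∀ x, 0 ≤ v x)
    (hfalse : ∀ y, g y = 1 →
      ∑ x, v x * |φ (Sum.elim x y)| < a * ∑ x, u x * |φ (Sum.elim x y)|)
    (htrue : ∀ y, g y = -1 → ∑ x, u x * |φ (Sum.elim x y)| < ∑ x, v x * |φ (Sum.elim x y)|) :
    HasRationalSeparation (2 * d) (4 * a ^ 2) g := by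
  obtain ⟨P, hP, hPv⟩ := exists_lowDegree_comparable_sq_sum_abs hφ hs hv
  obtain ⟨Q, hQ, hQu⟩ := exists_lowDegree_comparable_sq_sum_abs hφ hs hu
  have hnonneg {t : (σ → Bool) → ℝ} (ht : ∀ x, 0 ≤ t x) (y : τ → Bool) :
      0 ≤ ∑ x, t x * |φ (Sum.elim x y)| :=
    Finset.sum_nonneg fun x _ => mul_nonneg (ht x) (abs_nonneg _)
  refine ⟨_, Submodule.smul_mem _ 2 hP, Q, hQ, fun y => ⟨?_, ?_⟩, fun y hy => ?_, fun y hy => ?_⟩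
  · exact (sq_nonneg _).trans (hPv y).2
  · linarith [(sq_nonneg _).trans (hQu y).2]
  · have hlt := pow_lt_pow_left₀ (hfalse y hy) (hnonneg hv y) two_ne_zero
    rw [Pi.smul_apply, smul_eq_mul]
    nlinarith [hPv y, hQu y, sq_nonneg a]
  · have hlt := pow_lt_pow_left₀ (htrue y hy) (hnonneg hu y) two_ne_zero
    rw [Pi.smul_apply, smul_eq_mul]
    linarith [(hPv y).2, (hQu y).1]

theorem hasRationalApprox_or_hasRationalSeparation [Finite σ] [Finite τ]
    (hd : thresholdDegree (conjunction f g) ≤ d) (a : ℝ) :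
    HasRationalApprox d a f ∨ HasRationalSeparation (2 * d) (4 * a ^ 2) g := by
  classical
  have := Fintype.ofFinite σ
  have := Fintype.ofFinite τ
  obtain ⟨φ, hφ, hs⟩ := thresholdDegree_le_iff.1 hd
  let A : (σ → Bool) ⊕ (σ → Bool) → (τ → Bool) → ℝ :=
    Sum.elim (fun x y => if g y = -1 then |φ (Sum.elim x y)| else -(a * |φ (Sum.elim x y)|))
      fun x y => if g y = -1 then -|φ (Sum.elim x y)| else |φ (Sum.elim x y)|
  rcases exists_mem_stdSimplex_nonneg_or_neg A with ⟨w, hw, hA⟩ | ⟨u, hu, hA⟩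
  · refine Or.inl (hasRationalApprox_of_weights hφ hs hw (fun x => ?_) fun x => ?_)
    · have h := hA (Sum.inl x)
      simp only [A, Sum.elim_inl, mul_ite, Finset.sum_ite, mul_neg, Finset.sum_neg_distrib,
        mul_left_comm _ a, ← Finset.mul_sum] at h
      linarith
    · have h := hA (Sum.inr x)
      simp only [A, Sum.elim_inr, mul_ite, Finset.sum_ite, mul_neg, Finset.sum_neg_distrib] at h
      linarith
  · refine Or.inr (hasRationalSeparation_of_weights hφ hs (fun x => hu.1 (Sum.inl x))
      (fun x => hu.1 (Sum.inr x)) (fun y hy => ?_) fun y hy => ?_)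
    · have h := hA y
      simp only [A, Fintype.sum_sum_type, Sum.elim_inl, Sum.elim_inr, hy,
        if_neg (show (1 : ℤˣ) ≠ -1 by decide), mul_neg, Finset.sum_neg_distrib,
        mul_left_comm _ a, ← Finset.mul_sum] at h
      linarith
    · have h := hA y
      simp only [A, Fintype.sum_sum_type, Sum.elim_inl, Sum.elim_inr, hy, if_true, mul_neg,
        Finset.sum_neg_distrib] at h
      linarith

end Conjunction

/-! ### Real polynomials on geometric progressions -/

/-- The influence of a root of modulus `y * t` on the values of a polynomial on the annulus
`t ≤ |v| ≤ B * t`; the influence of a root at `0`, where `B / y = 0`, is `0` as it should be. -/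
noncomputable def annulusWeight (B y : ℝ) : ℝ := min 1 (min y (B / y))

/-- The total influence of the complex roots of `P` on its values on `t ≤ |v| ≤ B * t`. -/
noncomputable def rootWeight (B t : ℝ) (P : Polynomial ℝ) : ℝ :=
  ((P.aroots ℂ).map fun z => annulusWeight B (‖z‖ / t)).sum

/-- `P` is within relative error `1 / 7` of the monomial `k * v ^ e` for `t ≤ |v| ≤ B * t`. -/
def IsMonomialLike (B t : ℝ) (P : Polynomial ℝ) (k : ℝ) (e : ℕ) : Prop :=
  ∀ v : ℝ, t ≤ |v| → |v| ≤ B * t → |P.eval v - k * v ^ e| ≤ 1 / 7 * |k * v ^ e|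

section Annulus

variable {B t y : ℝ} {P Q : Polynomial ℝ}

lemma annulusWeight_nonneg (hB : 0 ≤ B) (hy : 0 ≤ y) : 0 ≤ annulusWeight B y := by
  unfold annulusWeight
  positivity

lemma sum_annulusWeight_map_nonneg (hB : 0 ≤ B) (ht : 0 ≤ t) (s : Multiset ℂ) :
    0 ≤ (s.map fun z => annulusWeight B (‖z‖ / t)).sum := by
  refine Multiset.sum_nonneg fun w hw => ?_
  obtain ⟨z, -, rfl⟩ := Multiset.mem_map.1 hw
  exact annulusWeight_nonneg hB (by positivity)

lemma annulusWeight_div_pow_succ_le (j : ℕ) : annulusWeight B (y / B ^ j) ≤ B ^ (j + 1) / y := by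
  refine ((min_le_right _ _).trans (min_le_right _ _)).trans_eq ?_
  rw [div_div_eq_mul_div, pow_succ']

lemma sum_annulusWeight_le_of_pow_le (hB : 2 ≤ B) (hy : 0 < y) (J : ℕ) :
    ∑ j ∈ Finset.range J, annulusWeight B (y / B ^ j) ≤ 2 * (B ^ J / y) := by
  induction J with
  | zero => simpa using hy.le
  | succ J ih =>
    have hratio : 2 * (B ^ J / y) ≤ B ^ (J + 1) / y := by
      rw [pow_succ', mul_div_assoc]
      gcongr
    rw [Finset.sum_range_succ]
    linarith [annulusWeight_div_pow_succ_le (B := B) (y := y) J]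

lemma sum_annulusWeight_le_of_lt_pow (hB : 2 ≤ B) (hy : 0 < y) {J : ℕ} (hJ : y < B ^ J) :
    ∑ j ∈ Finset.range J, annulusWeight B (y / B ^ j) ≤ 5 - 2 * (y / B ^ J) := by
  induction J with
  | zero =>
    rw [pow_zero] at hJ ⊢
    simp only [Finset.range_zero, Finset.sum_empty, div_one]
    linarith
  | succ J ih =>
    rw [Finset.sum_range_succ]
    rcases le_or_gt (B ^ J) y with hle | hlt
    · have hsum := sum_annulusWeight_le_of_pow_le hB hy J
      have hone : annulusWeight B (y / B ^ J) ≤ 1 := min_le_left _ _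
      have hpow : B ^ J / y ≤ 1 := (div_le_one hy).2 hle
      have hpow' : y / B ^ (J + 1) ≤ 1 := (div_le_one (by positivity)).2 hJ.le
      linarith
    · have hself : annulusWeight B (y / B ^ J) ≤ y / B ^ J :=
        (min_le_right _ _).trans (min_le_left _ _)
      have hratio : 2 * (y / B ^ (J + 1)) ≤ y / B ^ J := by
        rw [pow_succ', ← div_div, div_right_comm, mul_div_left_comm]
        exact mul_le_of_le_one_right (by positivity) ((div_le_one (by linarith)).2 hB)
      linarith [ih hlt]

lemma sum_annulusWeight_le (hB : 2 ≤ B) (hy : 0 ≤ y) (J : ℕ) :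
    ∑ j ∈ Finset.range J, annulusWeight B (y / B ^ j) ≤ 5 := by
  rcases hy.eq_or_lt with rfl | hy
  · simp [annulusWeight]
  rcases le_or_gt (B ^ J) y with hle | hlt
  · linarith [sum_annulusWeight_le_of_pow_le hB hy J, (div_le_one hy).2 hle]
  · have : 0 ≤ y / B ^ J := by positivity
    linarith [sum_annulusWeight_le_of_lt_pow hB hy hlt]

lemma sum_rootWeight_le (hB : 2 ≤ B) (ht : 0 ≤ t) (J : ℕ) (P : Polynomial ℝ) :
    ∑ j ∈ Finset.range J, rootWeight B (B ^ j * t) P ≤ 5 * P.natDegree := by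
  have hcard : (P.aroots ℂ).card ≤ P.natDegree :=
    (Polynomial.card_roots' _).trans Polynomial.natDegree_map_le
  calc ∑ j ∈ Finset.range J, rootWeight B (B ^ j * t) P
      = ((P.aroots ℂ).map fun z =>
          ∑ j ∈ Finset.range J, annulusWeight B (‖z‖ / (B ^ j * t))).sum :=
        (Multiset.sum_map_sum_map (P.aroots ℂ) (Finset.range J).val).symm
    _ ≤ (P.aroots ℂ).card • 5 := by
        refine (Multiset.sum_le_card_nsmul _ 5 fun w hw => ?_).trans_eq (by simp)
        obtain ⟨z, -, rfl⟩ := Multiset.mem_map.1 hw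
        simp only [mul_comm _ t, ← div_div]
        exact sum_annulusWeight_le hB (by positivity) J
    _ ≤ 5 * P.natDegree := by
        rw [nsmul_eq_mul, mul_comm]
        gcongr

lemma exists_rootWeight_add_le {J d : ℕ} (hB : 2 ≤ B) (hP : P.natDegree ≤ d)
    (hQ : Q.natDegree ≤ d) (hJ : 0 < J) (hJd : 100 * d ≤ J) :
    ∃ j < J, rootWeight B (B ^ j) P + rootWeight B (B ^ j) Q ≤ 1 / 10 := by
  simp only [← Finset.mem_range]
  refine Finset.exists_le_of_sum_le (by simpa using hJ.ne') ?_
  rw [Finset.sum_add_distrib, Finset.sum_const, Finset.card_range, nsmul_eq_mul]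
  have hP' : (P.natDegree : ℝ) ≤ d := by exact_mod_cast hP
  have hQ' : (Q.natDegree : ℝ) ≤ d := by exact_mod_cast hQ
  have hJd' : (100 * d : ℝ) ≤ J := by exact_mod_cast hJd
  have hsumP := sum_rootWeight_le hB zero_le_one J P
  have hsumQ := sum_rootWeight_le hB zero_le_one J Q
  simp only [mul_one] at hsumP hsumQ
  linarith

/-- Small roots are negligible next to `v`, and `v` is negligible next to large roots. -/
lemma norm_le_annulusWeight_mul_norm (ht : 0 < t) {z : ℂ} (hz : annulusWeight B (‖z‖ / t) < 1) :
    (∀ v : ℂ, t ≤ ‖v‖ → ‖v‖ ≤ B * t → ‖z‖ ≤ annulusWeight B (‖z‖ / t) * ‖v‖) ∨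
      z ≠ 0 ∧ ∀ v : ℂ, ‖v‖ ≤ B * t → ‖v‖ ≤ annulusWeight B (‖z‖ / t) * ‖z‖ := by
  rcases lt_or_ge ‖z‖ t with hzt | hzt
  · refine Or.inl fun v hv hv' => ?_
    have hv0 : 0 < ‖v‖ := ht.trans_le hv
    rw [← div_le_iff₀ hv0]
    refine le_min ((div_le_one hv0).2 (hzt.le.trans hv)) (le_min (by gcongr) ?_)
    rcases eq_or_ne z 0 with rfl | hz0
    · simp
    · rw [div_div_eq_mul_div, div_le_div_iff₀ hv0 (norm_pos_iff.2 hz0)]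
      nlinarith [norm_nonneg z]
  · have hz0 : 0 < ‖z‖ := ht.trans_le hzt
    refine Or.inr ⟨norm_pos_iff.1 hz0, fun v hv' => ?_⟩
    have hweight : annulusWeight B (‖z‖ / t) = B * t / ‖z‖ := by
      have hone : 1 ≤ ‖z‖ / t := (one_le_div ht).2 hzt
      unfold annulusWeight at hz ⊢
      rw [div_div_eq_mul_div] at hz ⊢
      have hlt := (min_lt_iff.1 hz).resolve_left (lt_irrefl 1)
      have hlt' := (min_lt_iff.1 hlt).resolve_left hone.not_gt
      rw [min_eq_right (hlt'.le.trans hone), min_eq_right hlt'.le]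
    rwa [hweight, div_mul_cancel₀ _ hz0.ne']

lemma exists_monomial_approx_sub (ht : 0 < t) {z : ℂ} (hz : annulusWeight B (‖z‖ / t) < 1) :
    ∃ (e : ℕ) (c : ℂ), c ≠ 0 ∧ ∀ v : ℂ, t ≤ ‖v‖ → ‖v‖ ≤ B * t →
      ‖(v - z) - c * v ^ e‖ ≤ annulusWeight B (‖z‖ / t) * ‖c * v ^ e‖ := by
  rcases norm_le_annulusWeight_mul_norm ht hz with h | ⟨hz0, h⟩
  · exact ⟨1, 1, one_ne_zero, fun v hv hv' => by simpa using h v hv hv'⟩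
  · exact ⟨0, -z, neg_ne_zero.2 hz0, fun v _ hv' => by simpa using h v hv'⟩

lemma norm_mul_sub_mul_le_exp {R : Type*} [NormedField R] {x x' y y' : R} {r s : ℝ} (hr : 0 ≤ r)
    (hx : ‖x - x'‖ ≤ r * ‖x'‖) (hy : ‖y - y'‖ ≤ (Real.exp s - 1) * ‖y'‖) :
    ‖x * y - x' * y'‖ ≤ (Real.exp (r + s) - 1) * ‖x' * y'‖ := by
  have hsplit : x * y - x' * y' = (x - x') * (y - y') + (x - x') * y' + x' * (y - y') := by ring
  calc ‖x * y - x' * y'‖ ≤ ‖x - x'‖ * ‖y - y'‖ + ‖x - x'‖ * ‖y'‖ + ‖x'‖ * ‖y - y'‖ := by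
        rw [hsplit]
        exact norm_add₃_le.trans_eq (by simp only [norm_mul])
    _ ≤ r * ‖x'‖ * ((Real.exp s - 1) * ‖y'‖) + r * ‖x'‖ * ‖y'‖ +
          ‖x'‖ * ((Real.exp s - 1) * ‖y'‖) := by gcongr
    _ = ((r + 1) * Real.exp s - 1) * ‖x' * y'‖ := by rw [norm_mul]; ring
    _ ≤ (Real.exp (r + s) - 1) * ‖x' * y'‖ := by
        rw [Real.exp_add]
        gcongr
        exact Real.add_one_le_exp r

lemma exists_monomial_approx_prod (hB : 0 ≤ B) (ht : 0 < t) (s : Multiset ℂ)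
    (hs : ∀ z ∈ s, annulusWeight B (‖z‖ / t) < 1) : ∃ (e : ℕ) (c : ℂ), c ≠ 0 ∧
      ∀ v : ℂ, t ≤ ‖v‖ → ‖v‖ ≤ B * t → ‖(s.map fun z => v - z).prod - c * v ^ e‖ ≤
        (Real.exp (s.map fun z => annulusWeight B (‖z‖ / t)).sum - 1) * ‖c * v ^ e‖ := by
  induction s using Multiset.induction_on with
  | empty => exact ⟨0, 1, one_ne_zero, by simp⟩
  | cons z s ih =>
    obtain ⟨e, c, hc, h⟩ := exists_monomial_approx_sub ht (hs z (Multiset.mem_cons_self z s))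
    obtain ⟨e', c', hc', h'⟩ := ih fun w hw => hs w (Multiset.mem_cons_of_mem hw)
    refine ⟨e + e', c * c', mul_ne_zero hc hc', fun v hv hv' => ?_⟩
    rw [Multiset.map_cons, Multiset.prod_cons, Multiset.map_cons, Multiset.sum_cons, pow_add,
      mul_mul_mul_comm]
    exact norm_mul_sub_mul_le_exp (annulusWeight_nonneg hB (by positivity)) (h v hv hv')
      (h' v hv hv')

lemma ofReal_eval_eq_prod_aroots (P : Polynomial ℝ) (v : ℝ) : ((P.eval v : ℝ) : ℂ) =
    P.leadingCoeff * ((P.aroots ℂ).map fun z => (v : ℂ) - z).prod := by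
  rw [← Complex.coe_algebraMap, ← Polynomial.aeval_algebraMap_apply_eq_algebraMap_eval]
  exact (IsAlgClosed.splits (P.map (algebraMap ℝ ℂ))).aeval_eq_prod_aroots (v : ℂ)

lemma exists_complex_monomial_approx (hB : 0 ≤ B) (ht : 0 < t) (hP : P ≠ 0)
    (hw : rootWeight B t P < 1) : ∃ (e : ℕ) (k : ℂ), k ≠ 0 ∧
      ∀ v : ℝ, t ≤ |v| → |v| ≤ B * t →
        ‖((P.eval v : ℝ) : ℂ) - k * (v : ℂ) ^ e‖ ≤
          (Real.exp (rootWeight B t P) - 1) * ‖k * (v : ℂ) ^ e‖ := by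
  have hlt : ∀ z ∈ P.aroots ℂ, annulusWeight B (‖z‖ / t) < 1 := fun z hz => by
    refine lt_of_le_of_lt (Multiset.single_le_sum (fun w hw => ?_) _
      (Multiset.mem_map_of_mem (fun z => annulusWeight B (‖z‖ / t)) hz)) hw
    obtain ⟨z, -, rfl⟩ := Multiset.mem_map.1 hw
    exact annulusWeight_nonneg hB (by positivity)
  obtain ⟨e, c, hc, h⟩ := exists_monomial_approx_prod hB ht _ hlt
  have hlead : (P.leadingCoeff : ℂ) ≠ 0 := by simpa using hP
  refine ⟨e, P.leadingCoeff * c, mul_ne_zero hlead hc, fun v hv hv' => ?_⟩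
  rw [ofReal_eval_eq_prod_aroots, mul_assoc, ← mul_sub, norm_mul, norm_mul, mul_left_comm]
  gcongr
  exact h v (by simpa using hv) (by simpa using hv')

lemma exp_one_tenth_sub_one_le : Real.exp (1 / 10) - 1 ≤ 1 / 8 := by
  have h := Real.add_one_le_exp (-(1 / 10) : ℝ)
  rw [Real.exp_neg, le_inv_comm₀ (by norm_num) (Real.exp_pos _)] at h
  norm_num at h ⊢
  linarith

lemma exists_isMonomialLike (hB : 1 ≤ B) (ht : 0 < t) (hP : P ≠ 0)
    (hw : rootWeight B t P ≤ 1 / 10) : ∃ (e : ℕ) (k : ℝ), k ≠ 0 ∧ IsMonomialLike B t P k e := by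
  have hB0 : 0 ≤ B := zero_le_one.trans hB
  obtain ⟨e, k, hk, h⟩ := exists_complex_monomial_approx hB0 ht hP (by linarith)
  have hexp : Real.exp (rootWeight B t P) - 1 ≤ 1 / 8 :=
    (sub_le_sub_right (Real.exp_le_exp.2 hw) 1).trans exp_one_tenth_sub_one_le
  have hbound (v : ℝ) (hv : t ≤ |v|) (hv' : |v| ≤ B * t) :
      ‖((P.eval v : ℝ) : ℂ) - k * ((v ^ e : ℝ) : ℂ)‖ ≤ 1 / 8 * (‖k‖ * |v ^ e|) := by
    push_cast
    refine (h v hv hv').trans ?_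
    rw [norm_mul, norm_pow, Complex.norm_real, Real.norm_eq_abs, abs_pow]
    gcongr
  have him : |k.im| ≤ 1 / 8 * ‖k‖ := by
    have habs : |t| = t := abs_of_pos ht
    have him' := (Complex.abs_im_le_norm _).trans
      (hbound t habs.ge (habs.trans_le (le_mul_of_one_le_left ht.le hB)))
    rw [Complex.sub_im, Complex.ofReal_im, Complex.im_mul_ofReal, zero_sub, abs_neg, abs_mul,
      ← mul_assoc] at him'
    exact le_of_mul_le_mul_right him' (abs_pos.2 (pow_ne_zero e ht.ne'))
  have hre : 7 / 8 * ‖k‖ ≤ |k.re| := by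
    linarith [Complex.norm_le_abs_re_add_abs_im k]
  refine ⟨e, k.re, fun h0 => ?_, fun v hv hv' => ?_⟩
  · rw [h0, abs_zero] at hre
    linarith [norm_pos_iff.2 hk]
  · have hre' := (Complex.abs_re_le_norm _).trans (hbound v hv hv')
    rw [Complex.sub_re, Complex.ofReal_re, Complex.re_mul_ofReal] at hre'
    rw [abs_mul]
    nlinarith [abs_nonneg (v ^ e)]

lemma IsMonomialLike.le_abs_eval {k v : ℝ} {e : ℕ} (h : IsMonomialLike B t P k e) (hv : t ≤ |v|)
    (hv' : |v| ≤ B * t) : 6 / 7 * (|k| * |v| ^ e) ≤ |P.eval v| := by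
  have h' := h v hv hv'
  have := abs_sub_abs_le_abs_sub (k * v ^ e) (P.eval v)
  rw [abs_sub_comm] at h'
  rw [abs_mul, abs_pow] at *
  linarith

lemma IsMonomialLike.abs_eval_le {k v : ℝ} {e : ℕ} (h : IsMonomialLike B t P k e) (hv : t ≤ |v|)
    (hv' : |v| ≤ B * t) : |P.eval v| ≤ 8 / 7 * (|k| * |v| ^ e) := by
  have h' := h v hv hv'
  have := abs_sub_abs_le_abs_sub (P.eval v) (k * v ^ e)
  rw [abs_mul, abs_pow] at *
  linarith

lemma IsMonomialLike.mul_eval_pos {k v : ℝ} {e : ℕ} (h : IsMonomialLike B t P k e) (hk : k ≠ 0)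
    (ht : 0 < t) (hv : t ≤ |v|) (hv' : |v| ≤ B * t) : 0 < k * v ^ e * P.eval v := by
  have hv0 : v ≠ 0 := abs_pos.1 (ht.trans_le hv)
  have hx : k * v ^ e ≠ 0 := mul_ne_zero hk (pow_ne_zero e hv0)
  have h' := h v hv hv'
  set x := k * v ^ e
  have hsq : x * x - x * P.eval v ≤ 1 / 7 * (x * x) :=
    calc x * x - x * P.eval v = -(x * (P.eval v - x)) := by ring
      _ ≤ |x| * |P.eval v - x| := by rw [← abs_mul]; exact neg_le_abs _
      _ ≤ |x| * (1 / 7 * |x|) := by gcongr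
      _ = 1 / 7 * (x * x) := by rw [mul_left_comm, abs_mul_abs_self]
  linarith [mul_self_pos.2 hx]

lemma IsMonomialLike.neg_one_pow_mul_pos {k : ℝ} {e : ℕ} (h : IsMonomialLike B t P k e)
    (hk : k ≠ 0) (hB : 1 ≤ B) (ht : 0 < t) : 0 < (-1) ^ e * (P.eval t * P.eval (-t)) := by
  have htB : |t| ≤ B * t := by rw [abs_of_pos ht]; nlinarith
  have hpos := h.mul_eval_pos hk ht (le_abs_self t) htB
  have hneg := h.mul_eval_pos hk ht ((le_abs_self t).trans_eq (abs_neg t).symm)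
    ((abs_neg t).trans_le htB)
  refine pos_of_mul_pos_right (a := (k * t ^ e) ^ 2) ?_ (sq_nonneg _)
  refine (mul_pos hpos hneg).trans_eq ?_
  rw [neg_pow t]
  ring

/-- Between `t` and `B * t`, a monomial of larger degree grows faster by a factor `B`. -/
lemma IsMonomialLike.exponent_le {k l b c : ℝ} {e m : ℕ} (hP : IsMonomialLike B t P k e)
    (hQ : IsMonomialLike B t Q l m) (hl : l ≠ 0) (hB : 1 ≤ B) (ht : 0 < t) (hb : 0 ≤ b)
    (hbc : 2 ≤ b * c * B) (hc : 0 ≤ c)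
    (h : b * |P.eval t| ≤ |Q.eval t|) (h' : c * |Q.eval (B * t)| ≤ |P.eval (B * t)|) : m ≤ e := by
  by_contra! hlt
  have habs : |t| = t := abs_of_pos ht
  have habs' : |B * t| = B * t := abs_of_pos (by positivity)
  have htB : t ≤ B * t := le_mul_of_one_le_left ht.le hB
  have hPt := hP.le_abs_eval habs.ge (habs.trans_le htB)
  have hPBt := hP.abs_eval_le (htB.trans_eq habs'.symm) habs'.le
  have hQt := hQ.abs_eval_le habs.ge (habs.trans_le htB)
  have hQBt := hQ.le_abs_eval (htB.trans_eq habs'.symm) habs'.le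
  rw [habs] at hPt hQt
  rw [habs', mul_pow] at hPBt hQBt
  have hpow : B * B ^ e ≤ B ^ m := by
    rw [← pow_succ']
    exact pow_le_pow_right₀ hB hlt
  have hlow : b * (6 / 7 * (|k| * t ^ e)) ≤ 8 / 7 * (|l| * t ^ m) :=
    (mul_le_mul_of_nonneg_left hPt hb).trans (h.trans hQt)
  have hupp : c * (6 / 7 * (|l| * (B ^ m * t ^ m))) ≤ 8 / 7 * (|k| * (B ^ e * t ^ e)) :=
    (mul_le_mul_of_nonneg_left hQBt hc).trans (h'.trans hPBt)
  have hpos : 0 < B ^ e * (|l| * t ^ m) := by positivity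
  have hchain : 36 * (2 * (B ^ e * (|l| * t ^ m))) ≤ 64 * (B ^ e * (|l| * t ^ m)) :=
    calc 36 * (2 * (B ^ e * (|l| * t ^ m)))
        ≤ 36 * (b * c * B * (B ^ e * (|l| * t ^ m))) := by gcongr
      _ = 36 * (b * c * (B * B ^ e) * (|l| * t ^ m)) := by ring
      _ ≤ 36 * (b * c * B ^ m * (|l| * t ^ m)) := by gcongr
      _ = 42 * b * (c * (6 / 7 * (|l| * (B ^ m * t ^ m)))) := by ring
      _ ≤ 42 * b * (8 / 7 * (|k| * (B ^ e * t ^ e))) := by gcongr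
      _ = 56 * B ^ e * (b * (6 / 7 * (|k| * t ^ e))) := by ring
      _ ≤ 56 * B ^ e * (8 / 7 * (|l| * t ^ m)) := by gcongr
      _ = 64 * (B ^ e * (|l| * t ^ m)) := by ring
  linarith

/-- Near a point of the progression with few roots of `P` and `Q` around it, both polynomials are
like monomials; the signs make the two degrees of different parity, so `P / Q` or `Q / P` grows by
a factor of about `B` between neighbouring points. -/
theorem not_rational_sign_approx {d J : ℕ} (hP : P.natDegree ≤ d) (hQ : Q.natDegree ≤ d) {a : ℝ}
    (ha : 0 < a) (hB : 2 ≤ B) (haB : 2 ≤ a * B) (hJ : 0 < J) (hJd : 100 * d ≤ J) :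
    ¬ ∀ j ≤ J, (0 < Q.eval (B ^ j) ∧ a * Q.eval (B ^ j) ≤ P.eval (B ^ j) ∧
      P.eval (B ^ j) ≤ Q.eval (B ^ j)) ∧ 0 < Q.eval (-B ^ j) ∧ P.eval (-B ^ j) < 0 := by
  intro h
  have hB1 : 1 ≤ B := by linarith
  obtain ⟨j, hj, hw⟩ := exists_rootWeight_add_le hB hP hQ hJ hJd
  obtain ⟨⟨hQt, hQPt, hPQt⟩, hQneg, hPneg⟩ := h j hj.le
  obtain ⟨⟨hQBt, hQPBt, hPQBt⟩, -⟩ := h (j + 1) hj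
  rw [pow_succ'] at hQBt hQPBt hPQBt
  have ht : 0 < B ^ j := by positivity
  set t := B ^ j
  have hPt : 0 < P.eval t := (mul_pos ha hQt).trans_le hQPt
  have hPBt : 0 < P.eval (B * t) := (mul_pos ha hQBt).trans_le hQPBt
  have hP0 : P ≠ 0 := by rintro rfl; simp at hPt
  have hQ0 : Q ≠ 0 := by rintro rfl; simp at hQt
  have hwP : 0 ≤ rootWeight B t P := sum_annulusWeight_map_nonneg (by linarith) ht.le _
  have hwQ : 0 ≤ rootWeight B t Q := sum_annulusWeight_map_nonneg (by linarith) ht.le _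
  obtain ⟨e, k, hk, hPk⟩ := exists_isMonomialLike hB1 ht hP0 (by linarith)
  obtain ⟨m, l, hl, hQl⟩ := exists_isMonomialLike hB1 ht hQ0 (by linarith)
  have hodd : Odd e := by
    by_contra hcon
    have := hPk.neg_one_pow_mul_pos hk hB1 ht
    rw [(Nat.not_odd_iff_even.1 hcon).neg_one_pow, one_mul] at this
    exact this.not_gt (mul_neg_of_pos_of_neg hPt hPneg)
  have heven : Even m := by
    by_contra hcon
    have := hQl.neg_one_pow_mul_pos hl hB1 ht
    rw [(Nat.not_even_iff_odd.1 hcon).neg_one_pow, neg_one_mul, neg_pos] at this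
    exact this.not_gt (mul_pos hQt hQneg)
  have hle : m ≤ e := hPk.exponent_le (b := 1) (c := a) hQl hl hB1 ht zero_le_one (by linarith)
    ha.le (by rwa [one_mul, abs_of_pos hPt, abs_of_pos hQt])
    (by rwa [abs_of_pos hPBt, abs_of_pos hQBt])
  have hge : e ≤ m := hQl.exponent_le (b := a) (c := 1) hPk hk hB1 ht ha.le (by linarith)
    zero_le_one (by rwa [abs_of_pos hPt, abs_of_pos hQt])
    (by rwa [one_mul, abs_of_pos hPBt, abs_of_pos hQBt])
  exact Nat.not_even_iff_odd.2 hodd (le_antisymm hle hge ▸ heven)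

end Annulus

/-! ### Polynomials at integers and at their negatives -/

lemma exists_factorial_le_norm_eval (G : Polynomial ℂ) : ∃ k ≤ G.natDegree,
    ‖G.leadingCoeff‖ * (G.natDegree.factorial : ℝ) ≤ 2 ^ G.natDegree * ‖G.eval (k : ℂ)‖ := by
  by_contra! hcon
  have hdiff := congrArg norm (congrFun G.fwdDiff_iter_degree_eq_factorial (0 : ℂ))
  rw [fwdDiff_iter_eq_sum_shift] at hdiff
  set e := G.natDegree
  set c := ‖G.leadingCoeff‖ * (e.factorial : ℝ)
  have hle : c ≤ ∑ k ∈ Finset.range (e + 1), (e.choose k : ℝ) * ‖G.eval (k : ℂ)‖ :=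
    calc c = _ := by rw [hdiff]; simp [c]
      _ ≤ _ := norm_sum_le _ _
      _ = _ := Finset.sum_congr rfl fun k _ => by simp
  have hlt : ∑ k ∈ Finset.range (e + 1), (e.choose k : ℝ) * ‖G.eval (k : ℂ)‖ <
      ∑ k ∈ Finset.range (e + 1), (e.choose k : ℝ) * (c / 2 ^ e) := by
    refine Finset.sum_lt_sum_of_nonempty (by simp) fun k hk => ?_
    have hk' : k ≤ e := Nat.lt_succ_iff.1 (Finset.mem_range.1 hk)
    refine mul_lt_mul_of_pos_left ?_ (by exact_mod_cast Nat.choose_pos hk')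
    rw [lt_div_iff₀' (by positivity)]
    exact hcon k hk'
  rw [← Finset.sum_mul, ← Nat.cast_sum, Nat.sum_range_choose, Nat.cast_pow, Nat.cast_ofNat,
    mul_div_cancel₀ _ (by positivity)] at hlt
  exact hle.not_gt hlt

lemma pow_self_mul_exp_neg_le_factorial (e : ℕ) :
    (e : ℝ) ^ e * Real.exp (-e) ≤ e.factorial := by
  have h := Real.pow_div_factorial_le_exp (x := e) e.cast_nonneg e
  rwa [Real.exp_neg, ← div_eq_mul_inv, div_le_comm₀ (Real.exp_pos _) (by positivity)]

/-- Apply the bound on iterated differences to `G` on an arithmetic progression of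
`G.natDegree + 1` integers with common difference about `t / G.natDegree`. -/
lemma exists_le_norm_eval_of_monic {G : Polynomial ℂ} (hG : G.Monic) {t : ℕ}
    (ht : G.natDegree ≤ t) : ∃ v : ℕ, t ≤ v ∧ v ≤ 2 * t ∧
      (t / 4 : ℝ) ^ G.natDegree * Real.exp (-G.natDegree) ≤ ‖G.eval (v : ℂ)‖ := by
  set e := G.natDegree with he
  rcases e.eq_zero_or_pos with h0 | hpos
  · refine ⟨t, le_rfl, by lia, ?_⟩
    rw [hG.natDegree_eq_zero.1 (he ▸ h0), h0]
    simp
  set m : ℕ := t / e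
  have hm : m * e ≤ t := Nat.div_mul_le_self t e
  have ht2 : t ≤ 2 * (m * e) := by
    have hm1 : 1 ≤ m := (Nat.one_le_div_iff hpos).2 ht
    have : t < m * e + e := Nat.lt_div_mul_add hpos
    nlinarith
  have hm0 : (m : ℂ) ≠ 0 := by
    have : m ≠ 0 := by rintro hm; simp [hm] at ht2; lia
    exact_mod_cast this
  let L : Polynomial ℂ := .C (m : ℂ) * .X + .C (t : ℂ)
  have hL : L.natDegree = 1 := Polynomial.natDegree_linear hm0
  have hdeg : (G.comp L).natDegree = e := by rw [Polynomial.natDegree_comp, hL, mul_one]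
  have hlead : ‖(G.comp L).leadingCoeff‖ = (m : ℝ) ^ e := by
    rw [Polynomial.leadingCoeff_comp (hL ▸ one_ne_zero), hG.leadingCoeff,
      Polynomial.leadingCoeff_linear hm0, one_mul, norm_pow, Complex.norm_natCast]
  obtain ⟨k, hk, h⟩ := exists_factorial_le_norm_eval (G.comp L)
  rw [hdeg] at hk
  rw [hdeg, hlead, Polynomial.eval_comp] at h
  have hkm : m * k ≤ m * e := Nat.mul_le_mul_left m hk
  refine ⟨m * k + t, by lia, by lia, ?_⟩
  have hv : ((m * k + t : ℕ) : ℂ) = L.eval (k : ℂ) := by simp [L]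
  have ht2' : (t / 4 : ℝ) ≤ m * e / 2 := by
    have : (t : ℝ) ≤ 2 * (m * e) := by exact_mod_cast ht2
    linarith
  rw [hv]
  calc (t / 4 : ℝ) ^ e * Real.exp (-e) ≤ (m * e / 2 : ℝ) ^ e * Real.exp (-e) := by gcongr
    _ = (m : ℝ) ^ e * ((e : ℝ) ^ e * Real.exp (-e)) / 2 ^ e := by rw [div_pow, mul_pow]; ring
    _ ≤ (m : ℝ) ^ e * e.factorial / 2 ^ e := by
        gcongr
        exact pow_self_mul_exp_neg_le_factorial e
    _ ≤ ‖G.eval (L.eval (k : ℂ))‖ := (div_le_iff₀' (by positivity)).2 h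

section Reflection

variable {t : ℝ} {z v : ℂ}

lemma norm_sub_le_exp_mul_norm_add_of_norm_le {E : Type*} [SeminormedAddCommGroup E] {x y : E}
    {r : ℝ} (hr : 0 ≤ r) (hr' : r ≤ 1 / 2) (h : ‖y‖ ≤ r * ‖x‖) :
    ‖x - y‖ ≤ Real.exp (3 * r) * ‖x + y‖ := by
  have hadd : (1 - r) * ‖x‖ ≤ ‖x + y‖ := by
    have := norm_sub_norm_le x (-y)
    rw [norm_neg, sub_neg_eq_add] at this
    linarith
  have hexp : 1 + r ≤ Real.exp (3 * r) * (1 - r) := by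
    nlinarith [Real.quadratic_le_exp_of_nonneg (x := 3 * r) (by positivity)]
  calc ‖x - y‖ ≤ (1 + r) * ‖x‖ := by linarith [norm_sub_le x y]
    _ ≤ Real.exp (3 * r) * (1 - r) * ‖x‖ := by gcongr
    _ ≤ Real.exp (3 * r) * ‖x + y‖ := by
      rw [mul_assoc]
      gcongr

lemma norm_sub_le_exp_mul_norm_add (ht : 0 < t) (hv : t ≤ ‖v‖) (hv' : ‖v‖ ≤ 2 * t)
    (hz : annulusWeight 2 (‖z‖ / t) ≤ 1 / 2) :
    ‖v - z‖ ≤ Real.exp (3 * annulusWeight 2 (‖z‖ / t)) * ‖v + z‖ := by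
  have hnonneg : 0 ≤ annulusWeight 2 (‖z‖ / t) :=
    annulusWeight_nonneg zero_le_two (by positivity)
  rcases norm_le_annulusWeight_mul_norm ht (hz.trans_lt one_half_lt_one) with h | ⟨-, h⟩
  · exact norm_sub_le_exp_mul_norm_add_of_norm_le hnonneg hz (h v hv hv')
  · rw [norm_sub_rev, add_comm]
    exact norm_sub_le_exp_mul_norm_add_of_norm_le hnonneg hz (h v hv')

lemma norm_le_of_half_lt_annulusWeight (ht : 0 < t) (hz : 1 / 2 < annulusWeight 2 (‖z‖ / t)) :
    ‖z‖ ≤ 4 * t := by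
  rcases eq_or_ne z 0 with rfl | hz0
  · rw [norm_zero]
    positivity
  have h := hz.trans_le ((min_le_right _ _).trans (min_le_right _ _))
  rw [div_div_eq_mul_div, lt_div_iff₀ (norm_pos_iff.2 hz0)] at h
  linarith

lemma norm_prod_map_le_exp_mul {α R : Type*} [NormedField R] {s : Multiset α} {f g : α → R}
    {r : α → ℝ} (h : ∀ a ∈ s, ‖f a‖ ≤ Real.exp (r a) * ‖g a‖) :
    ‖(s.map f).prod‖ ≤ Real.exp (s.map r).sum * ‖(s.map g).prod‖ := by
  have hnorm (k : α → R) : ‖(s.map k).prod‖ = (s.map fun a => ‖k a‖).prod :=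
    (map_multiset_prod (normHom : R →*₀ ℝ) (s.map k)).trans (by rw [Multiset.map_map]; rfl)
  rw [hnorm, hnorm, Real.exp_multiset_sum, Multiset.map_map, ← Multiset.prod_map_mul]
  exact Multiset.prod_map_le_prod_map₀ _ _ (fun a _ => norm_nonneg (f a)) h

lemma twenty_four_mul_exp_one_le : 24 * Real.exp 1 ≤ Real.exp 5 := by
  have hpow : Real.exp 5 = Real.exp 1 ^ 4 * Real.exp 1 := by
    rw [← pow_succ, ← Real.exp_nat_mul]
    norm_num
  rw [hpow]
  gcongr
  calc (24 : ℝ) ≤ 2.7 ^ 4 := by norm_num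
    _ ≤ Real.exp 1 ^ 4 := by
      gcongr
      linarith [Real.exp_one_gt_d9]

lemma norm_prod_map_sub_le_of_near {s : Multiset ℂ} (ht : 0 < t) (hv' : ‖v‖ ≤ 2 * t)
    (hs : ∀ z ∈ s, 1 / 2 < annulusWeight 2 (‖z‖ / t))
    (hv : (t / 4 : ℝ) ^ s.card * Real.exp (-s.card) ≤ ‖(s.map fun z => v + z).prod‖) :
    ‖(s.map fun z => v - z).prod‖ ≤
      Real.exp (s.map fun z => 10 * annulusWeight 2 (‖z‖ / t)).sum *
        ‖(s.map fun z => v + z).prod‖ := by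
  have hterm : ∀ z ∈ s, ‖v - z‖ ≤ Real.exp (10 * annulusWeight 2 (‖z‖ / t)) *
      ‖((t / 4 * Real.exp (-1) : ℝ) : ℂ)‖ := fun z hz => by
    have hexp : Real.exp 5 ≤ Real.exp (10 * annulusWeight 2 (‖z‖ / t)) :=
      Real.exp_le_exp.2 (by linarith [hs z hz])
    rw [Complex.norm_of_nonneg (by positivity)]
    calc ‖v - z‖ ≤ 24 * (t / 4) := by
          linarith [norm_sub_le v z, norm_le_of_half_lt_annulusWeight ht (hs z hz)]
      _ = 24 * Real.exp 1 * (t / 4 * Real.exp (-1)) := by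
          rw [Real.exp_neg]
          field_simp
      _ ≤ Real.exp (10 * annulusWeight 2 (‖z‖ / t)) * (t / 4 * Real.exp (-1)) := by
          gcongr
          exact twenty_four_mul_exp_one_le.trans hexp
  refine (norm_prod_map_le_exp_mul hterm).trans ?_
  gcongr
  refine le_trans (le_of_eq ?_) hv
  rw [Multiset.map_const', Multiset.prod_replicate, norm_pow,
    Complex.norm_of_nonneg (by positivity), mul_pow, ← Real.exp_nat_mul, mul_neg_one]

lemma card_le_two_mul_sum_annulusWeight {s : Multiset ℂ}
    (hs : ∀ z ∈ s, 1 / 2 < annulusWeight 2 (‖z‖ / t)) :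
    (s.card : ℝ) ≤ 2 * (s.map fun z => annulusWeight 2 (‖z‖ / t)).sum := by
  have h := Multiset.card_nsmul_le_sum (s := s.map fun z => annulusWeight 2 (‖z‖ / t))
    (a := (1 / 2 : ℝ)) fun w hw => by
      obtain ⟨z, hz, rfl⟩ := Multiset.mem_map.1 hw
      exact (hs z hz).le
  rw [Multiset.card_map, nsmul_eq_mul] at h
  linarith

lemma exists_norm_prod_map_sub_le_of_near {s : Multiset ℂ} {T : ℕ} (hT : 0 < T)
    (hs : ∀ z ∈ s, 1 / 2 < annulusWeight 2 (‖z‖ / T)) (hcard : s.card ≤ T) :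
    ∃ v : ℕ, T ≤ v ∧ v ≤ 2 * T ∧ ‖(s.map fun z => (v : ℂ) - z).prod‖ ≤
      Real.exp (s.map fun z => 10 * annulusWeight 2 (‖z‖ / T)).sum *
        ‖(s.map fun z => (v : ℂ) + z).prod‖ := by
  let G : Polynomial ℂ := (s.map fun z => .X - .C (-z)).prod
  have hGcard : G.natDegree = s.card := by
    simpa [G] using Polynomial.natDegree_multiset_prod_X_sub_C_eq_card (s.map Neg.neg)
  have hGmonic : G.Monic :=
    Polynomial.monic_multiset_prod_of_monic _ _ fun z _ => Polynomial.monic_X_sub_C (-z)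
  have hGeval (v : ℂ) : G.eval v = (s.map fun z => v + z).prod := by
    simp [G, Polynomial.eval_multiset_prod]
  obtain ⟨v, hv, hv', hlarge⟩ := exists_le_norm_eval_of_monic hGmonic (hGcard.trans_le hcard)
  rw [hGcard, hGeval] at hlarge
  refine ⟨v, hv, hv', norm_prod_map_sub_le_of_near (Nat.cast_pos.2 hT) ?_ hs hlarge⟩
  rw [Complex.norm_natCast]
  exact_mod_cast hv'

end Reflection

lemma abs_eval_eq_mul_norm_prod_sub (F : Polynomial ℝ) (v : ℝ) :
    |F.eval v| = |F.leadingCoeff| * ‖((F.aroots ℂ).map fun z => (v : ℂ) - z).prod‖ := by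
  rw [← Real.norm_eq_abs, ← Complex.norm_real, ofReal_eval_eq_prod_aroots, norm_mul,
    Complex.norm_real, Real.norm_eq_abs]

lemma abs_eval_neg_eq_mul_norm_prod_add (F : Polynomial ℝ) (v : ℝ) :
    |F.eval (-v)| = |F.leadingCoeff| * ‖((F.aroots ℂ).map fun z => (v : ℂ) + z).prod‖ := by
  have hneg : ((F.aroots ℂ).map fun z => ((-v : ℝ) : ℂ) - z) =
      ((F.aroots ℂ).map fun z => (v : ℂ) + z).map Neg.neg := by
    rw [Multiset.map_map]
    exact Multiset.map_congr rfl fun z _ => by push_cast [Function.comp_apply]; ring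
  rw [abs_eval_eq_mul_norm_prod_sub, hneg, Multiset.prod_map_neg]
  simp

/-- Roots of small weight affect `F v` and `F (-v)` almost equally, and there are so few others that
some integer `v` has `-v` far from all of them. -/
lemma exists_abs_eval_le_exp_rootWeight_mul {F : Polynomial ℝ} {T : ℕ} (hT : 0 < T)
    (hw : 2 * rootWeight 2 T F ≤ T) : ∃ v : ℕ, T ≤ v ∧ v ≤ 2 * T ∧
      |F.eval (v : ℝ)| ≤ Real.exp (10 * rootWeight 2 T F) * |F.eval (-(v : ℝ))| := by
  have hT0 : (0 : ℝ) < T := Nat.cast_pos.2 hT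
  let ω : ℂ → ℝ := fun z => annulusWeight 2 (‖z‖ / T)
  set near := (F.aroots ℂ).filter fun z => 1 / 2 < ω z
  set far := (F.aroots ℂ).filter fun z => ¬ 1 / 2 < ω z
  have hroots : F.aroots ℂ = near + far := (Multiset.filter_add_not _ _).symm
  have hnear' : ∀ z ∈ near, 1 / 2 < ω z := fun z hz => (Multiset.mem_filter.1 hz).2
  have hweight : rootWeight 2 T F = (near.map ω).sum + (far.map ω).sum := by
    rw [rootWeight, hroots, Multiset.map_add, Multiset.sum_add]
  have hfarsum : 0 ≤ (far.map ω).sum := sum_annulusWeight_map_nonneg zero_le_two hT0.le far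
  have hcard : near.card ≤ T := by
    have h2 : (near.card : ℝ) ≤ 2 * (near.map ω).sum := card_le_two_mul_sum_annulusWeight hnear'
    exact_mod_cast (by linarith : (near.card : ℝ) ≤ T)
  obtain ⟨v, hv, hv', hnearprod⟩ := exists_norm_prod_map_sub_le_of_near hT hnear' hcard
  have hvT : (T : ℝ) ≤ ‖(v : ℂ)‖ := by simpa using hv
  have hvT' : ‖(v : ℂ)‖ ≤ 2 * T := by
    rw [Complex.norm_natCast]
    exact_mod_cast hv'
  have hfarprod : ‖(far.map fun z => (v : ℂ) - z).prod‖ ≤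
      Real.exp (far.map fun z => 3 * ω z).sum * ‖(far.map fun z => (v : ℂ) + z).prod‖ :=
    norm_prod_map_le_exp_mul fun z hz =>
      norm_sub_le_exp_mul_norm_add hT0 hvT hvT' (not_lt.1 (Multiset.mem_filter.1 hz).2)
  rw [Multiset.sum_map_mul_left] at hnearprod hfarprod
  have hexp : Real.exp (10 * (near.map ω).sum) * Real.exp (3 * (far.map ω).sum) ≤
      Real.exp (10 * rootWeight 2 T F) := by
    rw [← Real.exp_add, hweight]
    gcongr
    linarith
  refine ⟨v, hv, hv', ?_⟩
  rw [abs_eval_neg_eq_mul_norm_prod_add, abs_eval_eq_mul_norm_prod_sub, hroots,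
    mul_left_comm]
  refine mul_le_mul_of_nonneg_left ?_ (abs_nonneg _)
  simp only [Multiset.map_add, Multiset.prod_add, norm_mul, Complex.ofReal_natCast]
  refine (mul_le_mul hnearprod hfarprod (norm_nonneg _) (by positivity)).trans ?_
  rw [mul_mul_mul_comm]
  gcongr

theorem exists_abs_eval_le_exp_mul {F : Polynomial ℝ} {D i J : ℕ} (hD : F.natDegree ≤ D)
    (hJ : 0 < J) (hi : 10 * D ≤ J * 2 ^ i) : ∃ v : ℕ, 1 ≤ v ∧ v ≤ 2 ^ (i + J) ∧
      |F.eval (v : ℝ)| ≤ Real.exp (50 * D / J) * |F.eval (-(v : ℝ))| := by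
  have hJ' : (0 : ℝ) < J := Nat.cast_pos.2 hJ
  obtain ⟨j, hj, hw⟩ : ∃ j ∈ Finset.range J, rootWeight 2 (2 ^ j * 2 ^ i) F ≤ 5 * D / J := by
    refine Finset.exists_le_of_sum_le (by simpa using hJ.ne') ?_
    rw [Finset.sum_const, Finset.card_range, nsmul_eq_mul, mul_div_cancel₀ _ hJ'.ne']
    have hD' : (F.natDegree : ℝ) ≤ D := by exact_mod_cast hD
    linarith [sum_rootWeight_le le_rfl (by positivity : (0 : ℝ) ≤ 2 ^ i) J F]
  have hpow : (2 : ℝ) ^ j * 2 ^ i = (2 ^ (j + i) : ℕ) := by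
    rw [← pow_add, Nat.cast_pow, Nat.cast_ofNat]
  rw [hpow] at hw
  have hbound : 2 * (5 * (D : ℝ) / J) ≤ (2 ^ (j + i) : ℕ) := by
    rw [← mul_div_assoc, ← mul_assoc, div_le_iff₀' hJ']
    norm_num only
    have : J * 2 ^ i ≤ J * 2 ^ (j + i) := by gcongr <;> lia
    exact_mod_cast hi.trans this
  obtain ⟨v, hv, hv', h⟩ := exists_abs_eval_le_exp_rootWeight_mul (T := 2 ^ (j + i))
    (by positivity) (le_trans (by gcongr) hbound)
  refine ⟨v, Nat.one_le_two_pow.trans hv, ?_, h.trans ?_⟩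
  · rw [← pow_succ'] at hv'
    exact hv'.trans (Nat.pow_le_pow_right two_pos (by have := Finset.mem_range.1 hj; lia))
  · gcongr
    calc 10 * rootWeight 2 (2 ^ (j + i) : ℕ) F ≤ 10 * (5 * D / J) := by gcongr
      _ = 50 * D / J := by ring

/-! ### Symmetrization on the levels of the cube -/

section Dist

variable {α : Type*} [Fintype α] {ν f g : α → ℝ}

lemma dotProduct_le_dotProduct_of_support (hν : 0 ≤ ν) (h : ∀ x, ν x ≠ 0 → f x ≤ g x) :
    ν ⬝ᵥ f ≤ ν ⬝ᵥ g := by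
  refine Finset.sum_le_sum fun x _ => ?_
  rcases eq_or_ne (ν x) 0 with hx | hx
  · simp only [hx, zero_mul, le_refl]
  · exact mul_le_mul_of_nonneg_left (h x hx) (hν x)

lemma dotProduct_pos_of_mem_stdSimplex (hν : ν ∈ stdSimplex ℝ α) (h : ∀ x, ν x ≠ 0 → 0 < f x) :
    0 < ν ⬝ᵥ f := by
  obtain ⟨x, -, hx⟩ := Finset.exists_ne_zero_of_sum_ne_zero (hν.2.trans_ne one_ne_zero)
  refine Finset.sum_pos' (fun y _ => ?_)
    ⟨x, Finset.mem_univ x, mul_pos ((hν.1 x).lt_of_ne' hx) (h x hx)⟩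
  rcases eq_or_ne (ν y) 0 with hy | hy
  · simp only [hy, zero_mul, le_refl]
  · exact mul_nonneg (hν.1 y) (h y hy).le

end Dist

section Moments

variable {σ : Type*} [Fintype σ] [DecidableEq σ] {d : ℕ} {T : Set ℕ} {ν : ℕ → (σ → Bool) → ℝ}

/-- For `t ∈ T`, the expectation under `ν t` of every function of degree at most `d` on the cube is
given by a polynomial in `t` of degree at most `d`. -/
def HasPolynomialMoments (d : ℕ) (T : Set ℕ) (ν : ℕ → (σ → Bool) → ℝ) : Prop :=
  ∀ f ∈ lowDegree σ d, ∃ R : Polynomial ℝ, R.natDegree ≤ d ∧ ∀ t ∈ T, ν t ⬝ᵥ f = R.eval (t : ℝ)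

lemma hasPolynomialMoments_of_cubeMonomial
    (h : ∀ S : Finset σ, S.card ≤ d →
      ∃ R : Polynomial ℝ, R.natDegree ≤ d ∧ ∀ t ∈ T, ν t ⬝ᵥ cubeMonomial S = R.eval (t : ℝ)) :
    HasPolynomialMoments d T ν := fun f hf => by
  induction hf using Submodule.span_induction with
  | mem f hf =>
    obtain ⟨S, hS, rfl⟩ := hf
    exact h S hS
  | zero => exact ⟨0, by simp, by simp⟩
  | add f g _ _ hf hg =>
    obtain ⟨p, hp, hpe⟩ := hf
    obtain ⟨q, hq, hqe⟩ := hg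
    exact ⟨p + q, (Polynomial.natDegree_add_le p q).trans (max_le hp hq),
      fun t ht => by rw [dotProduct_add, hpe t ht, hqe t ht, Polynomial.eval_add]⟩
  | smul a f _ hf =>
    obtain ⟨p, hp, hpe⟩ := hf
    exact ⟨a • p, (Polynomial.natDegree_smul_le a p).trans hp,
      fun t ht => by rw [dotProduct_smul, hpe t ht, Polynomial.eval_smul]⟩

end Moments

section Level

variable {κ : Type*} {k d : ℕ}

lemma cubeMonomial_decide_mem [DecidableEq κ] (B s : Finset κ) :
    cubeMonomial B (fun j => decide (j ∈ s)) = if B ⊆ s then 1 else 0 := by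
  simp [cubeMonomial_eq_ite, Finset.subset_iff]

variable [Fintype κ]

/-- The Hamming weight of a point of the cube. -/
def cubeWeight (y : κ → Bool) : ℕ := (Finset.univ.filter fun j => y j = true).card

/-- The uniform distribution on the points of the cube of Hamming weight `k`. -/
noncomputable def levelDistribution (κ : Type*) [Fintype κ] (k : ℕ) (y : κ → Bool) : ℝ :=
  if cubeWeight y = k then ((Fintype.card κ).choose k : ℝ)⁻¹ else 0

lemma cubeWeight_eq_of_levelDistribution_ne_zero {y : κ → Bool}
    (h : levelDistribution κ k y ≠ 0) : cubeWeight y = k := by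
  by_contra hk
  exact h (if_neg hk)

variable [DecidableEq κ]

lemma levelDistribution_dotProduct (f : (κ → Bool) → ℝ) :
    levelDistribution κ k ⬝ᵥ f = ((Fintype.card κ).choose k : ℝ)⁻¹ *
      ∑ s ∈ Finset.univ.powersetCard k, f fun j => decide (j ∈ s) := by
  have hsum : levelDistribution κ k ⬝ᵥ f = ∑ s : Finset κ,
      if s.card = k then ((Fintype.card κ).choose k : ℝ)⁻¹ * f fun j => decide (j ∈ s) else 0 :=
    (Fintype.sum_bijective (fun (s : Finset κ) j => decide (j ∈ s))
      ⟨fun s s' h => by ext j; simpa using congrFun h j,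
        fun y => ⟨Finset.univ.filter fun j => y j = true, by simp⟩⟩ _ _
      fun s => by simp [levelDistribution, cubeWeight]).symm
  rw [hsum, ← Finset.sum_filter, Finset.mul_sum, Finset.powersetCard_eq_filter,
    Finset.powerset_univ]

lemma levelDistribution_mem_stdSimplex (hk : k ≤ Fintype.card κ) :
    levelDistribution κ k ∈ stdSimplex ℝ (κ → Bool) := by
  refine ⟨fun y => ?_, ?_⟩
  · unfold levelDistribution
    split_ifs <;> positivity
  · have hpos : ((Fintype.card κ).choose k : ℝ) ≠ 0 := by
      exact_mod_cast (Nat.choose_pos hk).ne'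
    rw [← dotProduct_one, levelDistribution_dotProduct]
    simp [hpos]

lemma choose_mul_descFactorial_eq {N b : ℕ} (h : b ≤ k) :
    N.choose k * k.descFactorial b = N.descFactorial b * (N - b).choose (k - b) := by
  rw [Nat.descFactorial_eq_factorial_mul_choose, Nat.descFactorial_eq_factorial_mul_choose,
    mul_left_comm, Nat.choose_mul h, mul_assoc]

lemma levelDistribution_dotProduct_cubeMonomial (hk : k ≤ Fintype.card κ) (B : Finset κ) :
    levelDistribution κ k ⬝ᵥ cubeMonomial B =
      ((Fintype.card κ).descFactorial B.card : ℝ)⁻¹ * k.descFactorial B.card := by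
  set N := Fintype.card κ
  have hchoose : (N.choose k : ℝ) ≠ 0 := by exact_mod_cast (Nat.choose_pos hk).ne'
  have hdesc : (N.descFactorial B.card : ℝ) ≠ 0 := by
    rw [Nat.cast_ne_zero, Ne, Nat.descFactorial_eq_zero_iff_lt, not_lt]
    exact Finset.card_le_univ B
  rw [levelDistribution_dotProduct, inv_mul_eq_div, inv_mul_eq_div, div_eq_div_iff hchoose hdesc]
  simp only [cubeMonomial_decide_mem]
  rw [← Finset.natCast_card_filter]
  rcases le_or_gt B.card k with hBk | hBk
  · rw [Finset.card_filter_powersetCard_subset _ _ _ (Finset.subset_univ B) hBk]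
    norm_cast
    rw [mul_comm, mul_comm (k.descFactorial _), choose_mul_descFactorial_eq hBk,
      Finset.card_univ]
  · rw [Nat.descFactorial_eq_zero_iff_lt.2 hBk, Nat.cast_zero, zero_mul,
      mul_eq_zero_iff_right hdesc, Nat.cast_eq_zero, Finset.card_eq_zero,
      Finset.filter_eq_empty_iff]
    intro s hs hB
    exact hBk.not_ge ((Finset.mem_powersetCard.1 hs).2 ▸ Finset.card_le_card hB)

/-- Minsky–Papert symmetrization. -/
theorem hasPolynomialMoments_levelDistribution :
    HasPolynomialMoments d (Set.Iic (Fintype.card κ)) (levelDistribution κ) := by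
  refine hasPolynomialMoments_of_cubeMonomial fun B hB => ⟨Polynomial.C
    ((Fintype.card κ).descFactorial B.card : ℝ)⁻¹ * descPochhammer ℝ B.card, ?_, fun k hk => ?_⟩
  · exact (Polynomial.natDegree_C_mul_le _ _).trans_eq (descPochhammer_natDegree ..) |>.trans hB
  · rw [levelDistribution_dotProduct_cubeMonomial hk, Polynomial.eval_mul, Polynomial.eval_C,
      descPochhammer_eval_eq_descFactorial]

end Level

section Character

variable {ι : Type*}

/-- The character `(-1) ^ (∑ i ∈ S, x i)` of the cube. -/
def cubeCharacter (S : Finset ι) (x : ι → Bool) : ℝ := ∏ i ∈ S, if x i = true then -1 else 1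

lemma cubeCharacter_empty (x : ι → Bool) : cubeCharacter ∅ x = 1 := Finset.prod_empty

lemma abs_cubeCharacter (S : Finset ι) (x : ι → Bool) : |cubeCharacter S x| = 1 := by
  rw [cubeCharacter, Finset.abs_prod]
  exact Finset.prod_eq_one fun i _ => by split_ifs <;> simp

lemma cubeCharacter_sq (S : Finset ι) (x : ι → Bool) : cubeCharacter S x ^ 2 = 1 := by
  rw [← sq_abs, abs_cubeCharacter, one_pow]

lemma cubeMonomial_eq_sum_cubeCharacter [DecidableEq ι] (S : Finset ι) (x : ι → Bool) :
    cubeMonomial S x = ∑ T ∈ S.powerset, (1 / 2) ^ T.card * (-1 / 2) ^ (S \ T).card *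
      cubeCharacter (S \ T) x := by
  have hcoord (i : ι) : cubePoint x i = 1 / 2 + (-1 / 2) * if x i = true then -1 else 1 := by
    unfold cubePoint
    split_ifs <;> norm_num
  simp only [cubeMonomial, hcoord]
  rw [Finset.prod_add]
  refine Finset.sum_congr rfl fun T _ => ?_
  rw [Finset.prod_mul_distrib, Finset.prod_const, Finset.prod_const, cubeCharacter, mul_assoc]

lemma sum_cubeCharacter_mul [Fintype ι] [DecidableEq ι] (S T : Finset ι) :
    ∑ x, cubeCharacter S x * cubeCharacter T x = if S = T then 2 ^ Fintype.card ι else 0 := by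
  have hprod (x : ι → Bool) : cubeCharacter S x * cubeCharacter T x =
      ∏ i, if (i ∈ S ↔ i ∈ T) then 1 else if x i = true then (-1 : ℝ) else 1 := by
    rw [cubeCharacter, cubeCharacter, ← Fintype.prod_ite_mem S, ← Fintype.prod_ite_mem T,
      ← Finset.prod_mul_distrib]
    refine Finset.prod_congr rfl fun i _ => ?_
    by_cases hS : i ∈ S <;> by_cases hT : i ∈ T <;> cases x i <;> simp [hS, hT]
  rw [Fintype.sum_congr _ _ hprod, ← Fintype.prod_sum
    fun i b => if (i ∈ S ↔ i ∈ T) then 1 else if b = true then (-1 : ℝ) else 1]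
  split_ifs with h
  · simp [h]
  · obtain ⟨i, hi⟩ : ∃ i, ¬(i ∈ S ↔ i ∈ T) := not_forall.1 fun hST => h (Finset.ext hST)
    exact Finset.prod_eq_zero (Finset.mem_univ i) (by simp [hi])

lemma sum_cubeCharacter [Fintype ι] [DecidableEq ι] (S : Finset ι) :
    ∑ x, cubeCharacter S x = if S = ∅ then 2 ^ Fintype.card ι else 0 := by
  simpa only [cubeCharacter_empty, mul_one] using sum_cubeCharacter_mul S ∅

end Character

/-! ### Fibres of random subset sums -/

section FibreDeviation

variable {ι : Type*} [Fintype ι] {M : ℕ}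

/-- The subset sum `∑ i, z i * x i` modulo `M`. -/
def subsetSum (z : ι → ZMod M) (x : ι → Bool) : ZMod M := ∑ i, if x i = true then z i else 0

/-- The indicator function of the fibre `subsetSum z x = t`, centred by the density `1 / M` that
the fibre has on average over `z`. -/
noncomputable def fibreDeviation (z : ι → ZMod M) (t : ZMod M) (x : ι → Bool) : ℝ :=
  (if subsetSum z x = t then 1 else 0) - 1 / M

lemma sum_fibre (z : ι → ZMod M) (t : ZMod M) (f : (ι → Bool) → ℝ) [DecidableEq ι] :
    ∑ x with subsetSum z x = t, f x = (∑ x, f x) / M + ∑ x, f x * fibreDeviation z t x := by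
  rw [Finset.sum_filter, Finset.sum_div, ← Finset.sum_add_distrib]
  refine Finset.sum_congr rfl fun x _ => ?_
  unfold fibreDeviation
  split_ifs <;> ring

lemma subsetSum_add_single [DecidableEq ι] (z : ι → ZMod M) (i : ι) (u : ZMod M) (x : ι → Bool) :
    subsetSum (z + Pi.single i u) x = subsetSum z x + if x i = true then u else 0 := by
  have hterm (j : ι) : (if x j = true then (z + Pi.single i u : ι → ZMod M) j else 0) =
      (if x j = true then z j else 0) + if j = i then (if x i = true then u else 0) else 0 := by
    rcases eq_or_ne j i with rfl | h
    · simp only [Pi.add_apply, Pi.single_eq_same, if_true]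
      split_ifs <;> simp
    · simp [h]
  simp only [subsetSum, hterm, Finset.sum_add_distrib, Finset.sum_ite_eq', Finset.mem_univ, if_true]

lemma fibreDeviation_add_single_of_true [DecidableEq ι] {x : ι → Bool} {i : ι} (hx : x i = true)
    (z : ι → ZMod M) (u t : ZMod M) :
    fibreDeviation (z + Pi.single i u) t x = fibreDeviation z (t - u) x := by
  rw [fibreDeviation, fibreDeviation, subsetSum_add_single, if_pos hx]
  simp only [eq_sub_iff_add_eq]

lemma fibreDeviation_add_single_of_false [DecidableEq ι] {x : ι → Bool} {i : ι} (hx : x i = false)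
    (z : ι → ZMod M) (u t : ZMod M) :
    fibreDeviation (z + Pi.single i u) t x = fibreDeviation z t x := by
  rw [fibreDeviation, fibreDeviation, subsetSum_add_single, hx, if_neg Bool.false_ne_true, add_zero]

variable [NeZero M]

lemma sum_fibreDeviation (z : ι → ZMod M) (x : ι → Bool) : ∑ t, fibreDeviation z t x = 0 := by
  have hM : (M : ℝ) ≠ 0 := by exact_mod_cast NeZero.ne M
  simp [fibreDeviation, Finset.sum_sub_distrib, ZMod.card, hM]

lemma sum_fibreDeviation_sq_le (z : ι → ZMod M) (x : ι → Bool) :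
    ∑ t, fibreDeviation z t x ^ 2 ≤ 1 := by
  have hM : (0 : ℝ) < M := by exact_mod_cast NeZero.pos M
  have hsq (t : ZMod M) : fibreDeviation z t x ^ 2 =
      (if subsetSum z x = t then (1 - 1 / M : ℝ) else 0) - 1 / M * fibreDeviation z t x := by
    unfold fibreDeviation
    split_ifs <;> ring
  simp only [hsq, Finset.sum_sub_distrib, ← Finset.mul_sum, sum_fibreDeviation, Finset.sum_ite_eq,
    Finset.mem_univ, if_true, mul_zero, sub_zero]
  exact sub_le_self _ (by positivity)

variable [DecidableEq ι]

/-- Translating `z` in the direction `i` moves the fibre through `x` uniformly while it fixes the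
fibre through `x'`. -/
lemma sum_fibreDeviation_mul_of_true_of_false {x x' : ι → Bool} {i : ι} (hx : x i = true)
    (hx' : x' i = false) (t : ZMod M) :
    ∑ z : ι → ZMod M, fibreDeviation z t x * fibreDeviation z t x' = 0 := by
  have hM : (M : ℝ) ≠ 0 := by exact_mod_cast NeZero.ne M
  have htranslate (u : ZMod M) : ∑ z : ι → ZMod M, fibreDeviation z t x * fibreDeviation z t x' =
      ∑ z : ι → ZMod M, fibreDeviation z (t - u) x * fibreDeviation z t x' := by
    rw [← Equiv.sum_comp (Equiv.addRight (Pi.single i u : ι → ZMod M))]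
    simp only [Equiv.coe_addRight, fibreDeviation_add_single_of_true hx,
      fibreDeviation_add_single_of_false hx']
  have haverage (z : ι → ZMod M) : ∑ u, fibreDeviation z (t - u) x = 0 := by
    rw [← sum_fibreDeviation z x]
    exact Equiv.sum_comp (Equiv.subLeft t) fun s => fibreDeviation z s x
  refine (mul_eq_zero.1 ?_).resolve_left hM
  calc (M : ℝ) * ∑ z : ι → ZMod M, fibreDeviation z t x * fibreDeviation z t x'
      = ∑ _u : ZMod M, ∑ z : ι → ZMod M, fibreDeviation z t x * fibreDeviation z t x' := by
        simp [ZMod.card]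
    _ = ∑ u : ZMod M, ∑ z : ι → ZMod M, fibreDeviation z (t - u) x * fibreDeviation z t x' :=
        Finset.sum_congr rfl fun u _ => htranslate u
    _ = 0 := by
        rw [Finset.sum_comm]
        simp only [← Finset.sum_mul, haverage, zero_mul, Finset.sum_const_zero]

lemma sum_fibreDeviation_mul {x x' : ι → Bool} (hx : x ≠ x') (t : ZMod M) :
    ∑ z : ι → ZMod M, fibreDeviation z t x * fibreDeviation z t x' = 0 := by
  obtain ⟨i, hi⟩ := Function.ne_iff.1 hx
  cases h : x i
  · have h' : x' i = true := eq_true_of_ne_false fun h' => hi (h.trans h'.symm)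
    simp only [mul_comm (fibreDeviation _ t x)]
    exact sum_fibreDeviation_mul_of_true_of_false h' h t
  · have h' : x' i = false := eq_false_of_ne_true fun h' => hi (h.trans h'.symm)
    exact sum_fibreDeviation_mul_of_true_of_false h h' t

end FibreDeviation

lemma sum_sq_sum_mul_of_orthogonal {α β : Type*} [Fintype α] {D : α → β → ℝ}
    (hD : ∀ ⦃b b'⦄, b ≠ b' → ∑ a, D a b * D a b' = 0) (s : Finset β) (φ : β → ℝ) :
    ∑ a, (∑ b ∈ s, φ b * D a b) ^ 2 = ∑ b ∈ s, φ b ^ 2 * ∑ a, D a b ^ 2 := by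
  have hexpand (a : α) : (∑ b ∈ s, φ b * D a b) ^ 2 =
      ∑ b ∈ s, ∑ b' ∈ s, φ b * φ b' * (D a b * D a b') := by
    rw [sq, Finset.sum_mul_sum]
    simp only [mul_mul_mul_comm]
  simp only [hexpand]
  rw [Finset.sum_comm]
  refine Finset.sum_congr rfl fun b hb => ?_
  rw [Finset.sum_comm, Finset.sum_eq_single_of_mem b hb fun b' _ hb' => by
    rw [← Finset.mul_sum, hD hb'.symm, mul_zero], ← Finset.mul_sum]
  simp only [sq]

section Correlation

variable {ι : Type*} [Fintype ι] [DecidableEq ι] {M : ℕ} {𝒮 : Finset (Finset ι)}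
  {z : ι → ZMod M} {t : ZMod M}

/-- The correlation between the character of `S ∆ T` and a fibre of the subset sum. -/
noncomputable def fibreCorrelation (z : ι → ZMod M) (t : ZMod M) (S T : Finset ι) : ℝ :=
  ∑ x, cubeCharacter S x * cubeCharacter T x * fibreDeviation z t x

/-- The squared correlations of the products of two characters of `𝒮` with the fibre
`subsetSum z x = t` are at most `2 ^ card ι` on average. -/
def HasSmallCorrelations (𝒮 : Finset (Finset ι)) (z : ι → ZMod M) (t : ZMod M) : Prop :=
  ∑ S ∈ 𝒮, ∑ T ∈ 𝒮, fibreCorrelation z t S T ^ 2 ≤ (𝒮.card : ℝ) ^ 2 * 2 ^ Fintype.card ι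

lemma sum_sum_sq_fibreDeviation_le [NeZero M] {φ : (ι → Bool) → ℝ} (hφ : ∀ x, |φ x| ≤ 1) :
    ∑ z : ι → ZMod M, ∑ t, (∑ x, φ x * fibreDeviation z t x) ^ 2 ≤
      (M : ℝ) ^ Fintype.card ι * 2 ^ Fintype.card ι := by
  calc ∑ z : ι → ZMod M, ∑ t, (∑ x, φ x * fibreDeviation z t x) ^ 2
      = ∑ t, ∑ x, φ x ^ 2 * ∑ z : ι → ZMod M, fibreDeviation z t x ^ 2 := by
        rw [Finset.sum_comm]
        exact Finset.sum_congr rfl fun t _ =>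
          sum_sq_sum_mul_of_orthogonal (fun _ _ h => sum_fibreDeviation_mul h t) _ φ
    _ = ∑ x, φ x ^ 2 * ∑ z : ι → ZMod M, ∑ t, fibreDeviation z t x ^ 2 := by
        rw [Finset.sum_comm]
        refine Finset.sum_congr rfl fun x _ => ?_
        rw [← Finset.mul_sum, Finset.sum_comm]
    _ ≤ ∑ _x : ι → Bool, 1 * ∑ _z : ι → ZMod M, (1 : ℝ) := by
        gcongr with x _ z _
        · exact (sq_le_one_iff_abs_le_one _).2 (hφ x)
        · exact sum_fibreDeviation_sq_le z x
    _ = (M : ℝ) ^ Fintype.card ι * 2 ^ Fintype.card ι := by simp [ZMod.card, mul_comm]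

theorem exists_hasSmallCorrelations [NeZero M] (𝒮 : Finset (Finset ι)) :
    ∃ z : ι → ZMod M, ∀ t, HasSmallCorrelations 𝒮 z t := by
  obtain ⟨z, -, hz⟩ : ∃ z ∈ (Finset.univ : Finset (ι → ZMod M)),
      ∑ S ∈ 𝒮, ∑ T ∈ 𝒮, ∑ t, fibreCorrelation z t S T ^ 2 ≤
        (𝒮.card : ℝ) ^ 2 * 2 ^ Fintype.card ι := by
    refine Finset.exists_le_of_sum_le Finset.univ_nonempty ?_
    calc ∑ z : ι → ZMod M, ∑ S ∈ 𝒮, ∑ T ∈ 𝒮, ∑ t, fibreCorrelation z t S T ^ 2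
        = ∑ S ∈ 𝒮, ∑ T ∈ 𝒮, ∑ z : ι → ZMod M, ∑ t, fibreCorrelation z t S T ^ 2 := by
          rw [Finset.sum_comm]
          exact Finset.sum_congr rfl fun S _ => Finset.sum_comm
      _ ≤ ∑ S ∈ 𝒮, ∑ T ∈ 𝒮, (M : ℝ) ^ Fintype.card ι * 2 ^ Fintype.card ι := by
          refine Finset.sum_le_sum fun S _ => Finset.sum_le_sum fun T _ =>
            sum_sum_sq_fibreDeviation_le fun x => ?_
          rw [abs_mul, abs_cubeCharacter, abs_cubeCharacter, one_mul]
      _ = ∑ _z : ι → ZMod M, (𝒮.card : ℝ) ^ 2 * 2 ^ Fintype.card ι := by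
          simp only [Finset.sum_const, nsmul_eq_mul, Finset.card_univ, Fintype.card_fun, ZMod.card]
          push_cast
          ring
  refine ⟨z, fun t => le_trans ?_ hz⟩
  gcongr with S _ T _
  exact Finset.single_le_sum (f := fun t => fibreCorrelation z t S T ^ 2)
    (fun t _ => sq_nonneg _) (Finset.mem_univ t)

end Correlation

section FourierSum

variable {ι : Type*} {𝒮 : Finset (Finset ι)}

/-- The real function on the cube with Fourier coefficients `c S` for `S ∈ 𝒮`. -/
def fourierSum (𝒮 : Finset (Finset ι)) (c : Finset ι → ℝ) (x : ι → Bool) : ℝ :=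
  ∑ S ∈ 𝒮, c S * cubeCharacter S x

lemma fourierSum_sq_le (𝒮 : Finset (Finset ι)) (c : Finset ι → ℝ) (x : ι → Bool) :
    fourierSum 𝒮 c x ^ 2 ≤ 𝒮.card * ∑ S ∈ 𝒮, c S ^ 2 := by
  refine (Finset.sum_mul_sq_le_sq_mul_sq _ _ _).trans_eq ?_
  simp only [cubeCharacter_sq, Finset.sum_const, nsmul_eq_mul, mul_one]
  rw [mul_comm]

variable [DecidableEq ι]

lemma fourierSum_single_empty (h : ∅ ∈ 𝒮) (x : ι → Bool) :
    fourierSum 𝒮 (Pi.single ∅ 1) x = 1 := by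
  rw [fourierSum, Finset.sum_eq_single_of_mem ∅ h fun S _ hS => by
    rw [Pi.single_eq_of_ne hS, zero_mul], Pi.single_eq_same, one_mul, cubeCharacter_empty]

variable [Fintype ι] {c : Finset ι → ℝ}

lemma sum_fourierSum_eq_zero (hc : c ∅ = 0) : ∑ x, fourierSum 𝒮 c x = 0 := by
  unfold fourierSum
  rw [Finset.sum_comm]
  refine Finset.sum_eq_zero fun S _ => ?_
  rw [← Finset.mul_sum, sum_cubeCharacter]
  split_ifs with hS
  · rw [hS, hc, zero_mul]
  · rw [mul_zero]

lemma sum_fourierSum_sq (𝒮 : Finset (Finset ι)) (c : Finset ι → ℝ) :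
    ∑ x, fourierSum 𝒮 c x ^ 2 = 2 ^ Fintype.card ι * ∑ S ∈ 𝒮, c S ^ 2 := by
  have horth ⦃S T : Finset ι⦄ (h : S ≠ T) : ∑ x, cubeCharacter S x * cubeCharacter T x = 0 := by
    rw [sum_cubeCharacter_mul, if_neg h]
  unfold fourierSum
  rw [sum_sq_sum_mul_of_orthogonal horth, Finset.mul_sum]
  refine Finset.sum_congr rfl fun S _ => ?_
  simp only [cubeCharacter_sq, Finset.sum_const, nsmul_eq_mul, mul_one, Finset.card_univ,
    Fintype.card_fun, Fintype.card_bool, Nat.cast_pow, Nat.cast_ofNat]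
  rw [mul_comm]

variable {M : ℕ} {z : ι → ZMod M} {t : ZMod M}

lemma HasSmallCorrelations.abs_sum_fourierSum_mul_fibreDeviation_le
    (hz : HasSmallCorrelations 𝒮 z t) (h : ∅ ∈ 𝒮) (c : Finset ι → ℝ) :
    |∑ x, fourierSum 𝒮 c x * fibreDeviation z t x| ≤
      √(∑ S ∈ 𝒮, c S ^ 2) * (𝒮.card * √(2 ^ Fintype.card ι)) := by
  have hcorr : ∑ x, fourierSum 𝒮 c x * fibreDeviation z t x =
      ∑ S ∈ 𝒮, c S * fibreCorrelation z t S ∅ := by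
    simp only [fourierSum, fibreCorrelation, Finset.sum_mul, Finset.mul_sum, cubeCharacter_empty,
      mul_one, mul_assoc]
    exact Finset.sum_comm
  refine abs_le_of_sq_le_sq ?_ (by positivity)
  rw [hcorr, mul_pow, mul_pow, Real.sq_sqrt (by positivity), Real.sq_sqrt (by positivity)]
  refine (Finset.sum_mul_sq_le_sq_mul_sq _ _ _).trans ?_
  refine mul_le_mul_of_nonneg_left (le_trans ?_ hz) (by positivity)
  gcongr with S _
  exact Finset.single_le_sum (f := fun T => fibreCorrelation z t S T ^ 2)
    (fun T _ => sq_nonneg _) h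

lemma HasSmallCorrelations.abs_sum_fourierSum_sq_mul_fibreDeviation_le
    (hz : HasSmallCorrelations 𝒮 z t) (c : Finset ι → ℝ) :
    |∑ x, fourierSum 𝒮 c x ^ 2 * fibreDeviation z t x| ≤
      (∑ S ∈ 𝒮, c S ^ 2) * (𝒮.card * √(2 ^ Fintype.card ι)) := by
  have hexpand (x : ι → Bool) : fourierSum 𝒮 c x ^ 2 =
      ∑ q ∈ 𝒮 ×ˢ 𝒮, c q.1 * c q.2 * (cubeCharacter q.1 x * cubeCharacter q.2 x) := by
    rw [sq, fourierSum, Finset.sum_mul_sum, ← Finset.sum_product']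
    simp only [mul_mul_mul_comm]
  have hcorr : ∑ x, fourierSum 𝒮 c x ^ 2 * fibreDeviation z t x =
      ∑ q ∈ 𝒮 ×ˢ 𝒮, c q.1 * c q.2 * fibreCorrelation z t q.1 q.2 := by
    simp only [hexpand, fibreCorrelation, Finset.sum_mul, Finset.mul_sum, mul_assoc]
    exact Finset.sum_comm
  have hnorm : ∑ q ∈ 𝒮 ×ˢ 𝒮, (c q.1 * c q.2) ^ 2 = (∑ S ∈ 𝒮, c S ^ 2) ^ 2 := by
    rw [sq (∑ S ∈ 𝒮, c S ^ 2), Finset.sum_mul_sum, Finset.sum_product]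
    simp only [mul_pow]
  refine abs_le_of_sq_le_sq ?_ (by positivity)
  rw [hcorr, mul_pow, mul_pow, Real.sq_sqrt (by positivity), ← hnorm]
  refine (Finset.sum_mul_sq_le_sq_mul_sq _ _ _).trans ?_
  refine mul_le_mul_of_nonneg_left ?_ (by positivity)
  rw [Finset.sum_product]
  exact hz

end FourierSum

/-- The index sets of the characters of degree at most `d`. -/
def lowDegreeSets (ι : Type*) [Fintype ι] (d : ℕ) : Finset (Finset ι) :=
  Finset.univ.filter fun S => S.card ≤ d

lemma mem_lowDegreeSets {ι : Type*} [Fintype ι] {d : ℕ} {S : Finset ι} :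
    S ∈ lowDegreeSets ι d ↔ S.card ≤ d :=
  Finset.mem_filter_univ S

lemma card_lowDegreeSets_le (ι : Type*) [Fintype ι] (d : ℕ) :
    (lowDegreeSets ι d).card ≤ (Fintype.card ι + 1) ^ d := by
  classical
  have hsub : lowDegreeSets ι d ⊆
      (Finset.range (d + 1)).biUnion fun i => Finset.powersetCard i Finset.univ := fun S hS =>
    Finset.mem_biUnion.2 ⟨S.card, Finset.mem_range_succ_iff.2 (mem_lowDegreeSets.1 hS),
      Finset.mem_powersetCard_univ.2 rfl⟩
  refine (Finset.card_le_card hsub).trans (Finset.card_biUnion_le.trans ?_)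
  rw [add_pow]
  refine Finset.sum_le_sum fun i hi => ?_
  rw [Finset.card_powersetCard, Finset.card_univ, one_pow, mul_one]
  exact (Nat.choose_le_pow _ _).trans
    (Nat.le_mul_of_pos_right _ (Nat.choose_pos (Finset.mem_range_succ_iff.1 hi)))

section MomentMatching

variable {ι : Type*} [Fintype ι] [DecidableEq ι] {M : ℕ} [NeZero M] {𝒮 : Finset (Finset ι)}
  {z : ι → ZMod M} {t : ZMod M} {d : ℕ}

omit [DecidableEq ι] in
lemma two_mul_card_sq_mul_sqrt_lt (hM : 4 * M ^ 2 * 𝒮.card ^ 4 < 2 ^ Fintype.card ι) :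
    2 * (𝒮.card : ℝ) ^ 2 * √(2 ^ Fintype.card ι) < 2 ^ Fintype.card ι / M := by
  have hMpos : (0 : ℝ) < M := by exact_mod_cast NeZero.pos M
  have hsqrt : 2 * M * (𝒮.card : ℝ) ^ 2 < √(2 ^ Fintype.card ι) := by
    refine Real.lt_sqrt_of_sq_lt ?_
    calc (2 * M * (𝒮.card : ℝ) ^ 2) ^ 2 = 4 * M ^ 2 * (𝒮.card : ℝ) ^ 4 := by ring
      _ < 2 ^ Fintype.card ι := by exact_mod_cast hM
  rw [lt_div_iff₀ hMpos]
  calc 2 * (𝒮.card : ℝ) ^ 2 * √(2 ^ Fintype.card ι) * M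
      = 2 * M * (𝒮.card : ℝ) ^ 2 * √(2 ^ Fintype.card ι) := by ring
    _ < √(2 ^ Fintype.card ι) * √(2 ^ Fintype.card ι) := by gcongr
    _ = 2 ^ Fintype.card ι := Real.mul_self_sqrt (by positivity)

omit [Fintype ι] [DecidableEq ι] in
lemma card_mul_le_card_sq_mul {a : ℝ} (ha : 0 ≤ a) : 𝒮.card * a ≤ (𝒮.card : ℝ) ^ 2 * a :=
  mul_le_mul_of_nonneg_right (by exact_mod_cast Nat.le_self_pow two_ne_zero _) ha

lemma HasSmallCorrelations.exists_subsetSum_eq (hz : HasSmallCorrelations 𝒮 z t) (h : ∅ ∈ 𝒮)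
    (hM : 4 * M ^ 2 * 𝒮.card ^ 4 < 2 ^ Fintype.card ι) : ∃ x, subsetSum z x = t := by
  by_contra! hne
  have hsum : 0 = 2 ^ Fintype.card ι / M + ∑ x, fibreDeviation z t x := by
    simpa [hne] using sum_fibre z t fun _ => (1 : ℝ)
  have hcorr : |∑ x, fibreDeviation z t x| ≤ 𝒮.card * √(2 ^ Fintype.card ι) := by
    simpa [fourierSum_single_empty h, Pi.single_apply, h] using
      hz.abs_sum_fourierSum_mul_fibreDeviation_le h (Pi.single ∅ 1)
  have hr : 0 < √(2 ^ Fintype.card ι : ℝ) := by positivity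
  linarith [(abs_le.1 hcorr).1, two_mul_card_sq_mul_sqrt_lt hM,
    card_mul_le_card_sq_mul (𝒮 := 𝒮) hr.le, mul_nonneg (sq_nonneg (𝒮.card : ℝ)) hr.le]

/-- A negative function on the fibre has first and second moments of comparable size, because it is
bounded by its `L²` norm; small correlations make the first moment small and the second large. -/
theorem HasSmallCorrelations.exists_fourierSum_nonneg (hz : HasSmallCorrelations 𝒮 z t)
    (h : ∅ ∈ 𝒮) (hM : 4 * M ^ 2 * 𝒮.card ^ 4 < 2 ^ Fintype.card ι) {c : Finset ι → ℝ}
    (hc : c ∅ = 0) : ∃ x, subsetSum z x = t ∧ 0 ≤ fourierSum 𝒮 c x := by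
  by_contra! hneg
  set p := fourierSum 𝒮 c
  set N : ℝ := (𝒮.card : ℝ)
  set r := √(2 ^ Fintype.card ι)
  set k := √(∑ S ∈ 𝒮, c S ^ 2)
  set H : ℝ := 2 ^ Fintype.card ι
  have hk : k ^ 2 = ∑ S ∈ 𝒮, c S ^ 2 := Real.sq_sqrt (by positivity)
  have hbound (x : ι → Bool) : |p x| ≤ N * k := by
    refine abs_le_of_sq_le_sq ((fourierSum_sq_le 𝒮 c x).trans ?_) (by positivity)
    rw [mul_pow, hk]
    exact card_mul_le_card_sq_mul (by positivity)
  have hfirst : -(k * (N * r)) ≤ ∑ x with subsetSum z x = t, p x := by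
    rw [sum_fibre, sum_fourierSum_eq_zero hc, zero_div, zero_add]
    exact neg_le_of_abs_le (hz.abs_sum_fourierSum_mul_fibreDeviation_le h c)
  have hsecond : (H / M - N * r) * k ^ 2 ≤ ∑ x with subsetSum z x = t, p x ^ 2 := by
    rw [sum_fibre, sum_fourierSum_sq, ← hk, sub_mul, mul_div_right_comm, mul_comm (N * r), hk]
    linarith [neg_le_of_abs_le (hz.abs_sum_fourierSum_sq_mul_fibreDeviation_le c)]
  have hcompare : ∑ x with subsetSum z x = t, p x ^ 2 ≤
      N * k * -∑ x with subsetSum z x = t, p x := by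
    rw [← Finset.sum_neg_distrib, Finset.mul_sum]
    refine Finset.sum_le_sum fun x hx => ?_
    rw [← sq_abs, sq, ← abs_of_neg (hneg x (Finset.mem_filter.1 hx).2)]
    exact mul_le_mul_of_nonneg_right (hbound x) (abs_nonneg _)
  have hkpos : 0 < k := by
    obtain ⟨x, hx⟩ := hz.exists_subsetSum_eq h hM
    have := (abs_pos.2 (hneg x hx).ne).trans_le (hbound x)
    exact pos_of_mul_pos_right this (by positivity)
  have hle : (H / M - N * r) * k ^ 2 ≤ N ^ 2 * r * k ^ 2 := by
    refine (hsecond.trans hcompare).trans ?_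
    calc N * k * -∑ x with subsetSum z x = t, p x ≤ N * k * (k * (N * r)) := by
          gcongr
          linarith
      _ = N ^ 2 * r * k ^ 2 := by ring
  have hgap : H / M - N * r ≤ N ^ 2 * r := le_of_mul_le_mul_right hle (by positivity)
  linarith [two_mul_card_sq_mul_sqrt_lt hM, card_mul_le_card_sq_mul (𝒮 := 𝒮) (Real.sqrt_nonneg H)]

lemma exists_mem_stdSimplex_orthogonal_or_neg {I J : Type*} [Fintype I] [Nonempty I] [Fintype J]
    (A : I → J → ℝ) {s : Set J} (hs : s.Nonempty) :
    (∃ w ∈ stdSimplex ℝ J, (∀ j, w j ≠ 0 → j ∈ s) ∧ ∀ i, w ⬝ᵥ A i = 0) ∨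
      ∃ c : I → ℝ, ∀ j ∈ s, ∑ i, c i * A i j < 0 := by
  classical
  have := hs.to_subtype
  have hinj : Function.Injective (Subtype.val : s → J) := Subtype.val_injective
  rcases exists_mem_stdSimplex_nonneg_or_neg
      fun (i : I ⊕ I) (j : s) => i.elim (A · j) (-A · j) with ⟨w, hw, hnonneg⟩ | ⟨u, -, hneg⟩
  · have hext (f : J → ℝ) : Function.extend Subtype.val w 0 ⬝ᵥ f = ∑ j, w j * f j := by
      refine (Fintype.sum_of_injective _ hinj _ _ (fun j hj => ?_) fun j => ?_).symm
      · rw [Function.extend_apply' _ _ _ hj, Pi.zero_apply, zero_mul]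
      · rw [hinj.extend_apply]
    refine Or.inl ⟨Function.extend Subtype.val w 0, ⟨fun j => ?_, ?_⟩, fun j hj => ?_, fun i => ?_⟩
    · by_cases hj : ∃ a : s, ↑a = j
      · obtain ⟨a, rfl⟩ := hj
        rw [hinj.extend_apply]
        exact hw.1 a
      · rw [Function.extend_apply' _ _ _ hj, Pi.zero_apply]
    · simpa [hw.2, dotProduct_one] using hext 1
    · by_contra hjs
      exact hj (Function.extend_apply' _ _ _ fun ⟨a, ha⟩ => hjs (ha ▸ a.2))
    · rw [hext]
      refine le_antisymm ?_ (hnonneg (.inl i))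
      simpa using hnonneg (.inr i)
  · refine Or.inr ⟨fun i => u (.inl i) - u (.inr i), fun j hj => ?_⟩
    simpa [Fintype.sum_sum_type, sub_mul, ← sub_eq_add_neg] using hneg ⟨j, hj⟩

lemma dotProduct_eq_of_mem_lowDegree {μ ν : (ι → Bool) → ℝ}
    (h : ∀ S ∈ lowDegreeSets ι d, μ ⬝ᵥ cubeCharacter S = ν ⬝ᵥ cubeCharacter S)
    {f : (ι → Bool) → ℝ} (hf : f ∈ lowDegree ι d) : μ ⬝ᵥ f = ν ⬝ᵥ f := by
  induction hf using Submodule.span_induction with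
  | mem f hf =>
    obtain ⟨S, hS, rfl⟩ := hf
    have hexpand : cubeMonomial S = ∑ T ∈ S.powerset,
        ((1 / 2) ^ T.card * (-1 / 2) ^ (S \ T).card : ℝ) • cubeCharacter (S \ T) := by
      funext x
      simp only [cubeMonomial_eq_sum_cubeCharacter, Finset.sum_apply, Pi.smul_apply, smul_eq_mul]
    rw [hexpand, dotProduct_sum, dotProduct_sum]
    refine Finset.sum_congr rfl fun T _ => ?_
    rw [dotProduct_smul, dotProduct_smul, h _ <| mem_lowDegreeSets.2 <|
      (Finset.card_le_card Finset.sdiff_subset).trans hS]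
  | zero => rw [dotProduct_zero, dotProduct_zero]
  | add f g _ _ hf hg => rw [dotProduct_add, dotProduct_add, hf, hg]
  | smul a f _ hf => rw [dotProduct_smul, dotProduct_smul, hf]

/-- The uniform distribution on the cube. -/
noncomputable def cubeUniform (ι : Type*) [Fintype ι] (_ : ι → Bool) : ℝ :=
  (2 ^ Fintype.card ι)⁻¹

omit [NeZero M] in
lemma cubeUniform_dotProduct_cubeCharacter (S : Finset ι) :
    cubeUniform ι ⬝ᵥ cubeCharacter S = if S = ∅ then 1 else 0 := by
  simp only [dotProduct, cubeUniform, ← Finset.mul_sum, sum_cubeCharacter]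
  split_ifs
  · exact inv_mul_cancel₀ (by positivity)
  · exact mul_zero _

theorem HasSmallCorrelations.exists_moment_matching
    (hz : HasSmallCorrelations (lowDegreeSets ι d) z t)
    (hM : 4 * M ^ 2 * (lowDegreeSets ι d).card ^ 4 < 2 ^ Fintype.card ι) :
    ∃ μ ∈ stdSimplex ℝ (ι → Bool), (∀ x, μ x ≠ 0 → subsetSum z x = t) ∧
      ∀ f ∈ lowDegree ι d, μ ⬝ᵥ f = cubeUniform ι ⬝ᵥ f := by
  have hempty : ∅ ∈ lowDegreeSets ι d := mem_lowDegreeSets.2 (Nat.zero_le d)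
  rcases exists_mem_stdSimplex_orthogonal_or_neg (s := {x | subsetSum z x = t})
      (fun (S : Finset ι) x => if S ∈ (lowDegreeSets ι d).erase ∅ then cubeCharacter S x else 0)
      (hz.exists_subsetSum_eq hempty hM) with ⟨μ, hμ, hsupp, horth⟩ | ⟨c, hc⟩
  · refine ⟨μ, hμ, hsupp, fun f => dotProduct_eq_of_mem_lowDegree fun S hS => ?_⟩
    rw [cubeUniform_dotProduct_cubeCharacter]
    split_ifs with hS0
    · rw [← hμ.2, ← dotProduct_one, hS0]
      exact congrArg _ (funext cubeCharacter_empty)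
    · simpa only [Finset.mem_erase, ne_eq, hS0, hS, not_false_eq_true, and_self, if_true]
        using horth S
  · obtain ⟨x, hx, hnonneg⟩ := hz.exists_fourierSum_nonneg hempty hM
      (Function.update_self ∅ (0 : ℝ) c)
    refine absurd (hc x hx) (not_lt.2 (hnonneg.trans_eq ?_))
    rw [fourierSum, ← Finset.sum_erase _ (by rw [Function.update_self, zero_mul])]
    simp only [mul_ite, mul_zero, Finset.sum_ite_mem, Finset.univ_inter]
    refine Finset.sum_congr rfl fun S hS => ?_
    rw [Function.update_of_ne (Finset.ne_of_mem_erase hS)]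

end MomentMatching

/-! ### A halfspace without good rational approximations -/

section LevelProduct

variable {ι κ : Type*} {d : ℕ}

lemma cubeMonomial_elim (S : Finset (ι ⊕ κ)) (x : ι → Bool) (y : κ → Bool) :
    cubeMonomial S (Sum.elim x y) = cubeMonomial S.toLeft x * cubeMonomial S.toRight y := by
  conv_lhs => rw [← Finset.toLeft_disjSum_toRight (u := S), cubeMonomial, Finset.prod_disjSum]
  rfl

variable [Fintype κ] {μ : (ι → Bool) → ℝ} {q : (ι → Bool) → ℕ}

/-- The joint distribution of `(x, y)` when `x` has distribution `μ` and, given `x`, the point `y`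
is uniformly distributed on the points of Hamming weight `q x`. -/
noncomputable def levelProduct (κ : Type*) [Fintype κ] (μ : (ι → Bool) → ℝ) (q : (ι → Bool) → ℕ)
    (v : ι ⊕ κ → Bool) : ℝ :=
  μ (v ∘ Sum.inl) * levelDistribution κ (q (v ∘ Sum.inl)) (v ∘ Sum.inr)

variable [Fintype ι] [DecidableEq ι] [DecidableEq κ]

lemma levelProduct_dotProduct (f : (ι ⊕ κ → Bool) → ℝ) :
    levelProduct κ μ q ⬝ᵥ f =
      ∑ x, μ x * (levelDistribution κ (q x) ⬝ᵥ fun y => f (Sum.elim x y)) := by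
  rw [dotProduct, ← Equiv.sum_comp (Equiv.sumArrowEquivProdArrow ι κ Bool).symm,
    Fintype.sum_prod_type]
  refine Finset.sum_congr rfl fun x _ => ?_
  rw [dotProduct, Finset.mul_sum]
  exact Finset.sum_congr rfl fun y _ => mul_assoc _ _ _

lemma levelProduct_mem_stdSimplex (hμ : μ ∈ stdSimplex ℝ (ι → Bool))
    (hq : ∀ x, q x ≤ Fintype.card κ) :
    levelProduct κ μ q ∈ stdSimplex ℝ (ι ⊕ κ → Bool) := by
  refine ⟨fun v => mul_nonneg (hμ.1 _) ((levelDistribution_mem_stdSimplex (hq _)).1 _), ?_⟩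
  rw [← dotProduct_one, levelProduct_dotProduct, ← hμ.2]
  refine Finset.sum_congr rfl fun x _ => ?_
  exact (congrArg _ ((dotProduct_one _).trans (levelDistribution_mem_stdSimplex (hq x)).2)).trans
    (mul_one _)

lemma levelProduct_dotProduct_cubeMonomial (S : Finset (ι ⊕ κ)) :
    levelProduct κ μ q ⬝ᵥ cubeMonomial S = ∑ x, μ x *
      (cubeMonomial S.toLeft x * (levelDistribution κ (q x) ⬝ᵥ cubeMonomial S.toRight)) := by
  rw [levelProduct_dotProduct]
  refine Finset.sum_congr rfl fun x _ => ?_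
  rw [← smul_eq_mul (cubeMonomial _ _), ← dotProduct_smul]
  simp only [cubeMonomial_elim]
  rfl

end LevelProduct

lemma exists_polynomial_sum_mul_eval {α : Type*} [Fintype α] (R : Polynomial ℝ) (w L : α → ℝ)
    (m : ℝ) : ∃ G : Polynomial ℝ, G.natDegree ≤ R.natDegree ∧
      ∀ t, ∑ x, w x * R.eval ((L x - t) / m) = G.eval t := by
  refine ⟨∑ x, Polynomial.C (w x) * R.comp (Polynomial.C m⁻¹ * (Polynomial.C (L x) - Polynomial.X)),
    Polynomial.natDegree_sum_le_of_forall_le _ _ fun x _ => ?_, fun t => ?_⟩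
  · refine (Polynomial.natDegree_C_mul_le _ _).trans (Polynomial.natDegree_comp_le.trans ?_)
    refine (Nat.mul_le_mul_left _ ?_).trans_eq (mul_one _)
    exact (Polynomial.natDegree_C_mul_le _ _).trans (by compute_degree)
  · simp only [Polynomial.eval_finsetSum, Polynomial.eval_mul, Polynomial.eval_C,
      Polynomial.eval_comp, Polynomial.eval_sub, Polynomial.eval_X, div_eq_inv_mul]

section NatSubsetSum

variable {ι : Type*} [Fintype ι] {M : ℕ} [NeZero M]

/-- The integer subset sum `∑ i, z i * x i` of the least residues of the `z i`. -/
def natSubsetSum (z : ι → ZMod M) (x : ι → Bool) : ℕ := ∑ i, if x i = true then (z i).val else 0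

lemma natCast_natSubsetSum (z : ι → ZMod M) (x : ι → Bool) :
    ((natSubsetSum z x : ℕ) : ZMod M) = subsetSum z x := by
  simp only [natSubsetSum, subsetSum, Nat.cast_sum, Nat.cast_ite, ZMod.natCast_val, ZMod.cast_id',
    id_eq, Nat.cast_zero]

lemma natSubsetSum_div_le (z : ι → ZMod M) (x : ι → Bool) :
    natSubsetSum z x / M ≤ Fintype.card ι := by
  refine Nat.div_le_of_le_mul ?_
  refine (Finset.sum_le_card_nsmul Finset.univ _ M fun i _ => ?_).trans_eq (mul_comm _ _)
  split_ifs
  · exact (ZMod.val_lt _).le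
  · exact Nat.zero_le _

lemma natSubsetSum_eq {z : ι → ZMod M} {x : ι → Bool} {t : ℕ} (ht : t < M)
    (h : subsetSum z x = t) : natSubsetSum z x = t + M * (natSubsetSum z x / M) := by
  rw [← natCast_natSubsetSum, ZMod.natCast_eq_natCast_iff', Nat.mod_eq_of_lt ht] at h
  rw [← h, Nat.mod_add_div]

lemma natSubsetSum_mem_lowDegree (z : ι → ZMod M) :
    (fun x => (natSubsetSum z x : ℝ)) ∈ lowDegree ι 1 := by
  have hsum : (fun x => (natSubsetSum z x : ℝ)) =
      ∑ i, ((z i).val : ℝ) • fun x : ι → Bool => cubePoint x i := by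
    funext x
    simp [natSubsetSum, cubePoint]
  rw [hsum]
  exact Submodule.sum_mem _ fun i _ => Submodule.smul_mem _ _ (cubePoint_mem_lowDegree i)

end NatSubsetSum

section MatchingFibres

variable {σ : Type*} [Fintype σ] [DecidableEq σ] {d M : ℕ} {w : σ → ℤ}

/-- The integer linear form `∑ i, w i * x i` on the cube. -/
def integerForm (w : σ → ℤ) (x : σ → Bool) : ℤ := ∑ i, if x i = true then w i else 0

/-- The halfspace that is `1` exactly where the linear form with coefficients `w` exceeds `c`. -/
def thresholdFunction (w : σ → ℤ) (c : ℤ) (x : σ → Bool) : ℤˣ :=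
  if c < integerForm w x then 1 else -1

/-- The fibres of the linear form with coefficients `w` over `0, …, M - 1` carry probability
distributions whose moments up to degree `d` are polynomials in the value of the linear form. -/
def HasMatchingFibres (d M : ℕ) (w : σ → ℤ) : Prop :=
  ∃ ν : ℕ → (σ → Bool) → ℝ,
    (∀ t < M, ν t ∈ stdSimplex ℝ (σ → Bool) ∧ ∀ x, ν t x ≠ 0 → integerForm w x = t) ∧
    HasPolynomialMoments d (Set.Iio M) ν

end MatchingFibres

section Construction

variable {ι κ : Type*} [Fintype ι] [DecidableEq ι] [Fintype κ] [DecidableEq κ] {d M : ℕ}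

omit [DecidableEq ι] [DecidableEq κ] in
lemma integerForm_elim (z : ι → ZMod M) (v : ι ⊕ κ → Bool) :
    integerForm (Sum.elim (fun i => ((z i).val : ℤ)) fun _ => -(M : ℤ)) v =
      natSubsetSum z (v ∘ Sum.inl) - M * cubeWeight (v ∘ Sum.inr) := by
  rw [integerForm, Fintype.sum_sum_type]
  simp [natSubsetSum, cubeWeight, Finset.sum_ite, sub_eq_add_neg, mul_comm]

variable [NeZero M] {z : ι → ZMod M} {μ : ℕ → (ι → Bool) → ℝ}

omit [DecidableEq ι] in
lemma cubeMonomial_mul_eval_mem_lowDegree (S : Finset ι) (R : Polynomial ℝ) (t : ℝ) :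
    (fun x => cubeMonomial S x * R.eval ((natSubsetSum z x - t) / M)) ∈
      lowDegree ι (S.card + R.natDegree) := by
  refine mul_mem_lowDegree (cubeMonomial_mem_lowDegree le_rfl)
    (lowDegree_mono (mul_one _).le (polynomial_eval_comp_mem_lowDegree ?_ le_rfl))
  have hsub := Submodule.sub_mem _ (natSubsetSum_mem_lowDegree z) (const_mem_lowDegree t)
  convert Submodule.smul_mem _ (M : ℝ)⁻¹ hsub using 2
  exact div_eq_inv_mul _ _

lemma hasPolynomialMoments_levelProduct (hικ : Fintype.card ι ≤ Fintype.card κ)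
    (hsupp : ∀ t x, μ t x ≠ 0 → subsetSum z x = t)
    (hμ : ∀ t, ∀ f ∈ lowDegree ι d, μ t ⬝ᵥ f = cubeUniform ι ⬝ᵥ f) :
    HasPolynomialMoments d (Set.Iio M)
      fun t => levelProduct κ (μ t) fun x => natSubsetSum z x / M := by
  refine hasPolynomialMoments_of_cubeMonomial fun S hS => ?_
  rw [← Finset.card_toLeft_add_card_toRight] at hS
  obtain ⟨R, hR, hRe⟩ := hasPolynomialMoments_levelDistribution (cubeMonomial S.toRight)
    (cubeMonomial_mem_lowDegree le_rfl)
  obtain ⟨G, hG, hGe⟩ := exists_polynomial_sum_mul_eval R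
    (fun x => (2 ^ Fintype.card ι)⁻¹ * cubeMonomial S.toLeft x) (fun x => natSubsetSum z x) M
  refine ⟨G, by omega, fun t ht => ?_⟩
  have hdiv : ∀ x, μ t x ≠ 0 →
      ((natSubsetSum z x / M : ℕ) : ℝ) = (natSubsetSum z x - t) / M := fun x hx => by
    rw [eq_div_iff (Nat.cast_ne_zero.2 (NeZero.ne M)), eq_sub_iff_add_eq', mul_comm]
    exact_mod_cast (natSubsetSum_eq ht (hsupp t x hx)).symm
  calc levelProduct κ (μ t) (fun x => natSubsetSum z x / M) ⬝ᵥ cubeMonomial S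
      = μ t ⬝ᵥ fun x => cubeMonomial S.toLeft x * R.eval ((natSubsetSum z x - t : ℝ) / M) := by
        rw [levelProduct_dotProduct_cubeMonomial]
        refine Finset.sum_congr rfl fun x _ => ?_
        rcases eq_or_ne (μ t x) 0 with hx | hx
        · rw [hx, zero_mul, zero_mul]
        · rw [hRe _ ((natSubsetSum_div_le z x).trans hικ), hdiv x hx]
    _ = ∑ x, (2 ^ Fintype.card ι)⁻¹ * cubeMonomial S.toLeft x *
          R.eval ((natSubsetSum z x - t : ℝ) / M) := by
        rw [hμ t _ (lowDegree_mono (by omega) (cubeMonomial_mul_eval_mem_lowDegree _ R _))]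
        simp only [dotProduct, cubeUniform, mul_assoc]
    _ = G.eval (t : ℝ) := hGe t

theorem exists_hasMatchingFibres (hικ : Fintype.card ι ≤ Fintype.card κ)
    (hM : 4 * M ^ 2 * (lowDegreeSets ι d).card ^ 4 < 2 ^ Fintype.card ι) :
    ∃ w : ι ⊕ κ → ℤ, HasMatchingFibres d M w := by
  obtain ⟨z, hz⟩ := exists_hasSmallCorrelations (M := M) (lowDegreeSets ι d)
  choose μ hsimplex hsupp hμ using fun t : ℕ => (hz t).exists_moment_matching hM
  refine ⟨Sum.elim (fun i => ((z i).val : ℤ)) fun _ => -(M : ℤ), _,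
    fun t ht => ⟨?_, fun v hv => ?_⟩, hasPolynomialMoments_levelProduct hικ hsupp hμ⟩
  · exact levelProduct_mem_stdSimplex (hsimplex t) fun x => (natSubsetSum_div_le z x).trans hικ
  · rw [integerForm_elim z, natSubsetSum_eq ht (hsupp t _ (left_ne_zero_of_mul hv)),
      cubeWeight_eq_of_levelDistribution_ne_zero (right_ne_zero_of_mul hv)]
    push_cast
    ring

end Construction

section Threshold

variable {σ τ : Type*} {d : ℕ}

lemma HasRationalApprox.comp {a : ℝ} {f : (σ → Bool) → ℤˣ} (h : HasRationalApprox d a f)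
    {u : (τ → Bool) → σ → Bool} (hu : ∀ i, (fun y => cubePoint (u y) i) ∈ lowDegree τ 1) :
    HasRationalApprox d a fun y => f (u y) := by
  obtain ⟨p, hp, q, hq, hpq⟩ := h
  exact ⟨_, comp_mem_lowDegree hp hu, _, comp_mem_lowDegree hq hu, fun y => hpq (u y)⟩

variable [Fintype σ] [DecidableEq σ] {M : ℕ} {w : σ → ℤ}

lemma HasMatchingFibres.exists_univariate_approx (hw : HasMatchingFibres d M w) {a : ℝ} (ha : 0 < a)
    {c : ℕ} (h : HasRationalApprox d a (thresholdFunction w c)) :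
    ∃ P Q : Polynomial ℝ, P.natDegree ≤ d ∧ Q.natDegree ≤ d ∧ ∀ t < M, 0 < Q.eval (t : ℝ) ∧
      (c < t → a * Q.eval (t : ℝ) ≤ P.eval (t : ℝ) ∧ P.eval (t : ℝ) ≤ Q.eval (t : ℝ)) ∧
      (t ≤ c → P.eval (t : ℝ) < 0) := by
  obtain ⟨p, hp, q, hq, hpq⟩ := h
  obtain ⟨ν, hν, hmom⟩ := hw
  obtain ⟨P, hP, hPe⟩ := hmom p hp
  obtain ⟨Q, hQ, hQe⟩ := hmom q hq
  refine ⟨P, Q, hP, hQ, fun t ht => ?_⟩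
  obtain ⟨hsimplex, hform⟩ := hν t ht
  rw [← hPe t ht, ← hQe t ht]
  refine ⟨dotProduct_pos_of_mem_stdSimplex hsimplex fun x _ => (hpq x).1, fun hlt => ?_,
    fun hle => ?_⟩
  · have happrox : ∀ x, ν t x ≠ 0 → a * q x ≤ p x ∧ p x ≤ q x := fun x hx => by
      have hf : thresholdFunction w c x = 1 := if_pos (by rw [hform x hx]; exact_mod_cast hlt)
      simpa only [hf, Units.val_one, Int.cast_one, one_mul] using (hpq x).2
    rw [← smul_eq_mul, ← dotProduct_smul]
    exact ⟨dotProduct_le_dotProduct_of_support hsimplex.1 fun x hx => (happrox x hx).1,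
      dotProduct_le_dotProduct_of_support hsimplex.1 fun x hx => (happrox x hx).2⟩
  · rw [← neg_pos, ← dotProduct_neg]
    refine dotProduct_pos_of_mem_stdSimplex hsimplex fun x hx => ?_
    have hf : thresholdFunction w c x = -1 :=
      if_neg (by rw [hform x hx]; exact_mod_cast hle.not_gt)
    simpa only [hf, Units.val_neg, Units.val_one, Int.cast_neg, Int.cast_one, neg_one_mul,
      Pi.neg_apply] using (mul_pos ha (hpq x).1).trans_le (hpq x).2.1

theorem HasMatchingFibres.not_hasRationalApprox (hw : HasMatchingFibres d M w) {B J : ℕ}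
    (hB : 2 ≤ B) (hJ : 0 < J) (hJd : 100 * d ≤ J) (hBM : 2 * B ^ J < M) {a : ℝ} (ha : 0 < a)
    (haB : 2 ≤ a * B) : ¬ HasRationalApprox d a (thresholdFunction w (B ^ J : ℕ)) := fun h => by
  obtain ⟨P, Q, hP, hQ, hPQ⟩ := hw.exists_univariate_approx ha h
  let shift : Polynomial ℝ := .X + .C ((B : ℝ) ^ J)
  have hshift : shift.natDegree = 1 := Polynomial.natDegree_X_add_C _
  refine not_rational_sign_approx (P := P.comp shift) (Q := Q.comp shift) (B := B)
    (by rwa [Polynomial.natDegree_comp, hshift, mul_one])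
    (by rwa [Polynomial.natDegree_comp, hshift, mul_one]) ha (by exact_mod_cast hB) haB hJ hJd
    fun j hj => ?_
  have hpow : B ^ j ≤ B ^ J := Nat.pow_le_pow_right (by omega) hj
  have hpos : 0 < B ^ j := Nat.pow_pos (by omega)
  have hadd : (B : ℝ) ^ j + B ^ J = (B ^ j + B ^ J : ℕ) := by push_cast; rfl
  have hsub : -(B : ℝ) ^ j + B ^ J = (B ^ J - B ^ j : ℕ) := by
    rw [Nat.cast_sub hpow]; push_cast; ring
  simp only [shift, Polynomial.eval_comp, Polynomial.eval_add, Polynomial.eval_X,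
    Polynomial.eval_C, hadd, hsub]
  obtain ⟨hQadd, habove, -⟩ := hPQ (B ^ j + B ^ J) (by omega)
  obtain ⟨hQsub, -, hbelow⟩ := hPQ (B ^ J - B ^ j) (by omega)
  exact ⟨⟨hQadd, habove (by omega)⟩, hQsub, hbelow (by omega)⟩

end Threshold

lemma isHalfspace_thresholdFunction {n : ℕ} (w : Fin n → ℤ) (c : ℤ) :
    IsHalfspace (thresholdFunction w c) := by
  refine ⟨fun i => w i, c + 1 / 2, fun x => ?_⟩
  have hform : ∑ i, (w i : ℝ) * cubePoint x i = integerForm w x := by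
    simp [integerForm, cubePoint]
  rw [units_eq_sign_iff, hform, thresholdFunction]
  split_ifs with h
  · have hle : (c : ℝ) + 1 ≤ integerForm w x := by exact_mod_cast h
    simp only [Units.val_one, Int.cast_one, one_mul]
    linarith
  · have hle : (integerForm w x : ℝ) ≤ c := by exact_mod_cast not_lt.1 h
    simp only [Units.val_neg, Units.val_one, Int.cast_neg, Int.cast_one]
    linarith

theorem exists_isHalfspace_not_hasRationalApprox {n d B J : ℕ} (hB : 2 ≤ B) (hJ : 0 < J)
    (hJd : 100 * d ≤ J) (hn : 4 * (2 * B ^ J + 1) ^ 2 * (n / 2 + 1) ^ (4 * d) < 2 ^ (n / 2)) {a : ℝ}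
    (ha : 0 < a) (haB : 2 ≤ a * B) :
    ∃ h : (Fin n → Bool) → ℤˣ, IsHalfspace h ∧ ¬ HasRationalApprox d a h := by
  have hcard : 4 * (2 * B ^ J + 1) ^ 2 * (lowDegreeSets (Fin (n / 2)) d).card ^ 4 <
      2 ^ Fintype.card (Fin (n / 2)) := by
    rw [Fintype.card_fin]
    refine lt_of_le_of_lt ?_ hn
    rw [mul_comm 4 d, pow_mul]
    gcongr
    simpa only [Fintype.card_fin] using card_lowDegreeSets_le (Fin (n / 2)) d
  obtain ⟨w, hw⟩ := exists_hasMatchingFibres (κ := Fin (n - n / 2))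
    (by simp only [Fintype.card_fin]; omega) hcard
  let e : Fin n ≃ Fin (n / 2) ⊕ Fin (n - n / 2) :=
    (finCongr (by omega)).trans finSumFinEquiv.symm
  refine ⟨_, isHalfspace_thresholdFunction (w ∘ e) (B ^ J : ℕ), fun happrox => ?_⟩
  refine hw.not_hasRationalApprox hB hJ hJd (Nat.lt_succ_self _) ha haB ?_
  convert happrox.comp (u := fun x i => x (e i)) fun i => cubePoint_mem_lowDegree (e i)
    using 2 with x
  unfold thresholdFunction
  congr 2
  exact (Equiv.sum_comp e fun i => if x i = true then w i else 0).symm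

/-! ### Rational separation of the majority function -/

lemma sum_cubePoint {σ : Type*} [Fintype σ] (y : σ → Bool) :
    ∑ i, cubePoint y i = cubeWeight y := by
  simp only [cubePoint, cubeWeight, Finset.natCast_card_filter]

lemma majority_eq_ite {n : ℕ} (y : Fin n → Bool) :
    majority n y = if n / 2 < cubeWeight y then -1 else 1 := by
  have hhalf : (n : ℝ) / 2 < cubeWeight y ↔ n / 2 < cubeWeight y := by
    rw [div_lt_iff₀ two_pos, Nat.div_lt_iff_lt_mul two_pos]
    exact_mod_cast Iff.rfl
  simp only [majority, sum_cubePoint, hhalf]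

lemma HasRationalSeparation.exists_univariate_separation {n d : ℕ} {ε : ℝ}
    (h : HasRationalSeparation d ε (majority n)) :
    ∃ R S : Polynomial ℝ, R.natDegree ≤ d ∧ S.natDegree ≤ d ∧ ∀ k : ℕ, k ≤ n →
      (0 ≤ R.eval (k : ℝ) ∧ 0 ≤ S.eval (k : ℝ)) ∧
      (k ≤ n / 2 → R.eval (k : ℝ) < ε * S.eval (k : ℝ)) ∧
      (n / 2 < k → S.eval (k : ℝ) < R.eval (k : ℝ)) := by
  obtain ⟨P, hP, Q, hQ, hnonneg, hfalse, htrue⟩ := h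
  obtain ⟨R, hR, hRe⟩ := hasPolynomialMoments_levelDistribution P hP
  obtain ⟨S, hS, hSe⟩ := hasPolynomialMoments_levelDistribution Q hQ
  refine ⟨R, S, hR, hS, fun k hk => ?_⟩
  have hk' : k ≤ Fintype.card (Fin n) := by rwa [Fintype.card_fin]
  have hsimplex := levelDistribution_mem_stdSimplex hk'
  have hmaj : ∀ y, levelDistribution (Fin n) k y ≠ 0 → majority n y = if n / 2 < k then -1 else 1 :=
    fun y hy => by rw [majority_eq_ite, cubeWeight_eq_of_levelDistribution_ne_zero hy]
  rw [← hRe k hk', ← hSe k hk']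
  refine ⟨⟨dotProduct_nonneg_of_nonneg hsimplex.1 fun y => (hnonneg y).1,
    dotProduct_nonneg_of_nonneg hsimplex.1 fun y => (hnonneg y).2⟩, fun hle => ?_, fun hlt => ?_⟩
  · rw [← smul_eq_mul, ← dotProduct_smul, ← sub_pos, ← dotProduct_sub]
    exact dotProduct_pos_of_mem_stdSimplex hsimplex fun y hy =>
      sub_pos.2 (hfalse y ((hmaj y hy).trans (if_neg hle.not_gt)))
  · rw [← sub_pos, ← dotProduct_sub]
    exact dotProduct_pos_of_mem_stdSimplex hsimplex fun y hy =>
      sub_pos.2 (htrue y ((hmaj y hy).trans (if_pos hlt)))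

/-- For the symmetrizations `R`, `S` and `c = n / 2`, the polynomial `R (c + X) * S (c - X)` is much
larger at positive integers than at their negatives. -/
theorem HasRationalSeparation.one_le_mul_exp {n d i J : ℕ} {ε : ℝ}
    (h : HasRationalSeparation d ε (majority n)) (hJ : 0 < J) (hi : 20 * d ≤ J * 2 ^ i)
    (hn : 2 ^ (i + J) ≤ n / 2) : 1 ≤ ε * Real.exp (100 * d / J) := by
  obtain ⟨R, S, hR, hS, hRS⟩ := h.exists_univariate_separation
  set c : ℕ := n / 2
  let F : Polynomial ℝ := R.comp (.C (c : ℝ) + .X) * S.comp (.C (c : ℝ) - .X)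
  have hdeg : F.natDegree ≤ 2 * d := by
    refine Polynomial.natDegree_mul_le.trans ((add_le_add ?_ ?_).trans_eq (two_mul d).symm)
    · exact Polynomial.natDegree_comp_le.trans
        ((Nat.mul_le_mul hR (by compute_degree)).trans_eq (mul_one d))
    · exact Polynomial.natDegree_comp_le.trans
        ((Nat.mul_le_mul hS (by compute_degree)).trans_eq (mul_one d))
  obtain ⟨v, hv1, hv2, hv⟩ := exists_abs_eval_le_exp_mul hdeg hJ (i := i) (by omega)
  have hvc : v ≤ c := hv2.trans hn
  have hF : F.eval (v : ℝ) = R.eval ((c + v : ℕ) : ℝ) * S.eval ((c - v : ℕ) : ℝ) := by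
    simp [F, Nat.cast_sub hvc]
  have hFneg : F.eval (-(v : ℝ)) = R.eval ((c - v : ℕ) : ℝ) * S.eval ((c + v : ℕ) : ℝ) := by
    simp [F, Nat.cast_sub hvc, sub_eq_add_neg]
  obtain ⟨⟨-, hSup⟩, -, habove⟩ := hRS (c + v) (by omega)
  obtain ⟨⟨hRdown, hSdown⟩, hbelow, -⟩ := hRS (c - v) (by omega)
  rw [hF, hFneg] at hv
  set p₁ := R.eval ((c + v : ℕ) : ℝ)
  set p₂ := R.eval ((c - v : ℕ) : ℝ)
  set q₁ := S.eval ((c + v : ℕ) : ℝ)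
  set q₂ := S.eval ((c - v : ℕ) : ℝ)
  have hqp : q₁ < p₁ := habove (by omega)
  have hpq : p₂ < ε * q₂ := hbelow (by omega)
  have hq₂ : 0 < q₂ := hSdown.lt_of_ne' fun h0 => by simp [h0, hRdown.not_gt] at hpq
  have hεq₂ : 0 ≤ ε * q₂ := hRdown.trans hpq.le
  have hpos : 0 < p₁ * q₂ := mul_pos (hSup.trans_lt hqp) hq₂
  rw [abs_of_pos hpos, abs_of_nonneg (mul_nonneg hRdown hSup)] at hv
  refine le_of_mul_le_mul_right ?_ hpos
  calc 1 * (p₁ * q₂) ≤ Real.exp (50 * (2 * d : ℕ) / J) * (p₂ * q₁) := by rwa [one_mul]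
    _ ≤ Real.exp (50 * (2 * d : ℕ) / J) * ((ε * q₂) * p₁) := by gcongr
    _ = Real.exp (100 * d / J) * ((ε * q₂) * p₁) := by
        congr 2; push_cast; ring
    _ = ε * Real.exp (100 * d / J) * (p₁ * q₂) := by ring

/-! ### Intermediate threshold degrees -/

section Restriction

variable {σ τ : Type*}

lemma thresholdDegree_le_add_one [Finite τ] [DecidableEq τ] {F : (τ → Bool) → ℤˣ} {d : ℕ} (i : τ)
    (hF : ∀ b, thresholdDegree (fun x => F (Function.update x i b)) ≤ d) :
    thresholdDegree F ≤ d + 1 := by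
  choose f hf hs using fun b => thresholdDegree_le_iff.1 (hF b)
  refine thresholdDegree_le_iff.2 ⟨∑ b, f b * fun x => if x i = b then 1 else 0,
    Submodule.sum_mem _ fun b _ => mul_mem_lowDegree (hf b) (boole_coord_eq_mem_lowDegree i b),
    fun x => ?_⟩
  simpa [Finset.sum_apply] using hs (x i) x

lemma thresholdDegree_conjunction_const_le [Finite σ] [Finite τ] (u : ℤˣ)
    (g : (τ → Bool) → ℤˣ) :
    thresholdDegree (conjunction (fun _ : σ → Bool => u) g) ≤ thresholdDegree g := by
  rcases Int.units_eq_one_or u with rfl | rfl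
  · refine (thresholdDegree_le_iff.2 ⟨fun _ => 1, const_mem_lowDegree 1, ?_⟩).trans (Nat.zero_le _)
    exact fun z => by simp [conjunction]
  · obtain ⟨f, hf, hs⟩ := thresholdDegree_le_iff.1 (le_refl (thresholdDegree g))
    refine thresholdDegree_le_iff.2 ⟨fun z => f fun j => z (Sum.inr j),
      comp_mem_lowDegree hf fun j => cubePoint_mem_lowDegree (Sum.inr j), fun z => ?_⟩
    have hconj : conjunction (fun _ : σ → Bool => -1) g z = g fun j => z (Sum.inr j) := by
      rcases Int.units_eq_one_or (g fun j => z (Sum.inr j)) with h | h <;> simp [conjunction, h]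
    exact hconj ▸ hs _

lemma conjunction_update [DecidableEq σ] [DecidableEq τ] (f : (σ → Bool) → ℤˣ)
    (g : (τ → Bool) → ℤˣ) (i : σ) (b : Bool) :
    conjunction (fun x => f (Function.update x i b)) g =
      fun z => conjunction f g (Function.update z (Sum.inl i) b) := by
  funext z
  have hinl : (fun j => Function.update z (Sum.inl i) b (Sum.inl j)) =
      Function.update (fun j => z (Sum.inl j)) i b :=
    Function.update_comp_eq_of_injective z Sum.inl_injective i b
  have hinr : (fun j => Function.update z (Sum.inl i) b (Sum.inr j)) = fun j => z (Sum.inr j) :=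
    funext fun j => Function.update_of_ne Sum.inr_ne_inl _ _
  simp only [conjunction, hinl, hinr]

end Restriction

section Halfspace

variable {n : ℕ} {h : (Fin n → Bool) → ℤˣ}

lemma IsHalfspace.update (hh : IsHalfspace h) (i : Fin n) (b : Bool) :
    IsHalfspace fun x => h (Function.update x i b) := by
  obtain ⟨a, θ, hs⟩ := hh
  refine ⟨Function.update a i 0, θ - a i * (if b then 1 else 0), fun x => (hs _).trans ?_⟩
  have hterm : ∀ j, a j * cubePoint (Function.update x i b) j =
      Function.update a i 0 j * cubePoint x j + if j = i then a i * (if b then 1 else 0) else 0 :=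
    fun j => by rcases eq_or_ne j i with rfl | hj <;> simp_all [cubePoint]
  rw [Finset.sum_congr rfl fun j _ => hterm j, Finset.sum_add_distrib, Finset.sum_ite_eq',
    if_pos (Finset.mem_univ i), sub_sub_eq_add_sub]

/-- Restricting the coordinates of a halfspace one at a time, down to a constant function, lowers
the threshold degree by at most one in each step. -/
theorem exists_isHalfspace_thresholdDegree_eq {τ : Type*} [Finite τ] {g : (τ → Bool) → ℤˣ} {T : ℕ}
    (hg : thresholdDegree g ≤ T) (hh : IsHalfspace h)
    (hT : T ≤ thresholdDegree (conjunction h g)) :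
    ∃ h' : (Fin n → Bool) → ℤˣ, IsHalfspace h' ∧ thresholdDegree (conjunction h' g) = T := by
  classical
  suffices key : ∀ (s : Finset (Fin n)) (h : (Fin n → Bool) → ℤˣ), IsHalfspace h → DependsOn h s →
      T ≤ thresholdDegree (conjunction h g) →
      ∃ h' : (Fin n → Bool) → ℤˣ, IsHalfspace h' ∧ thresholdDegree (conjunction h' g) = T from
    key Finset.univ h hh (by simpa using dependsOn_univ h) hT
  intro s
  induction s using Finset.induction_on with
  | empty =>
    intro h hh hdep hT
    refine ⟨h, hh, le_antisymm ?_ hT⟩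
    have hconst : h = fun _ => h fun _ => false :=
      funext fun x => DependsOn.empty (by simpa using hdep) _ _
    rw [hconst]
    exact (thresholdDegree_conjunction_const_le _ g).trans hg
  | insert i s hi ih =>
    intro h hh hdep hT
    rcases hT.eq_or_lt with heq | hlt
    · exact ⟨h, hh, heq.symm⟩
    obtain ⟨b, hb⟩ :
        ∃ b, T ≤ thresholdDegree (conjunction (fun x => h (Function.update x i b)) g) := by
      by_contra! hcon
      have hle := thresholdDegree_le_add_one (F := conjunction h g) (d := T - 1) (Sum.inl i)
        fun b => by rw [← conjunction_update]; exact Nat.le_sub_one_of_lt (hcon b)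
      have hpos := hcon false
      omega
    refine ih _ (hh.update i b) (fun x y hxy => hdep fun j hj => ?_) hb
    rcases eq_or_ne j i with rfl | hne
    · simp only [Function.update_self]
    · rw [Function.update_of_ne hne, Function.update_of_ne hne]
      exact hxy j (Finset.mem_of_mem_insert_of_ne hj hne)

end Halfspace

lemma thresholdDegree_majority_le (n : ℕ) : thresholdDegree (majority n) ≤ 1 := by
  refine thresholdDegree_le_iff.2 ⟨(fun _ => (n : ℝ) / 2 + 1 / 4) - ∑ i, fun y => cubePoint y i,
    Submodule.sub_mem _ (const_mem_lowDegree _)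
      (Submodule.sum_mem _ fun i _ => cubePoint_mem_lowDegree i), fun y => ?_⟩
  rw [majority_eq_ite, Pi.sub_apply, Finset.sum_apply, sum_cubePoint]
  split_ifs with h
  · have hle : (n : ℝ) + 1 ≤ 2 * cubeWeight y := by exact_mod_cast (by omega)
    simp only [Units.val_neg, Units.val_one, Int.cast_neg, Int.cast_one]
    linarith
  · have hle : (2 * cubeWeight y : ℝ) ≤ n := by exact_mod_cast (by omega)
    simp only [Units.val_one, Int.cast_one]
    linarith

/-! ### The choice of parameters -/

section Parameters

variable {n : ℕ}

lemma mul_cube_le_two_pow {l : ℕ} (hl : 100 ≤ l) : 1000000 * l ^ 3 ≤ 2 ^ l := by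
  induction l, hl using Nat.le_induction with
  | base => norm_num
  | succ l hl ih =>
    have hcube : (l + 1) ^ 3 ≤ 2 * l ^ 3 := by
      nlinarith [mul_le_mul hl hl (by norm_num) (by omega)]
    rw [pow_succ 2]
    omega

lemma two_pow_log_le (hl : 0 < Nat.log 2 n) : 2 ^ Nat.log 2 n ≤ n :=
  Nat.pow_log_le_self 2 <| by rintro rfl; simp at hl

/-- A degree of order `√(n log n)`. The constant leaves room in the estimates below, where it is
shown that a conjunction of this degree yields neither a rational approximation of a suitable
halfspace nor a rational separation of the majority function. -/
def intersectionDegree (n : ℕ) : ℕ := Nat.sqrt (n * Nat.log 2 n) / 2000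

lemma intersectionDegree_sq_le (n : ℕ) : (2000 * intersectionDegree n) ^ 2 ≤ n * Nat.log 2 n :=
  (Nat.pow_le_pow_left (Nat.mul_div_le _ _) 2).trans (Nat.sqrt_le' _)

lemma lt_intersectionDegree_add_one_sq (n : ℕ) :
    n * Nat.log 2 n < (2000 * (intersectionDegree n + 1)) ^ 2 :=
  (Nat.lt_succ_sqrt' _).trans_le <|
    Nat.pow_le_pow_left (Nat.succ_le_of_lt (Nat.lt_mul_div_succ _ (by norm_num))) 2

lemma intersectionDegree_pos (hl : 100 ≤ Nat.log 2 n) : 0 < intersectionDegree n := by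
  by_contra! hcon
  have hlt := lt_intersectionDegree_add_one_sq n
  rw [Nat.le_zero.1 hcon] at hlt
  have hn := (mul_cube_le_two_pow hl).trans (two_pow_log_le (by omega))
  have hlog : 100 ^ 3 ≤ Nat.log 2 n ^ 3 := Nat.pow_le_pow_left hl 3
  nlinarith

lemma intersectionDegree_mul_log_le (hl : 100 ≤ Nat.log 2 n) :
    2000000 * (intersectionDegree n * Nat.log 2 n) ≤ n := by
  set l := Nat.log 2 n
  refine (Nat.pow_le_pow_iff_left two_ne_zero).1 ?_
  calc (2000000 * (intersectionDegree n * l)) ^ 2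
      = 1000000 * l ^ 2 * (2000 * intersectionDegree n) ^ 2 := by ring
    _ ≤ 1000000 * l ^ 2 * (n * l) := Nat.mul_le_mul_left _ (intersectionDegree_sq_le n)
    _ = 1000000 * l ^ 3 * n := by ring
    _ ≤ n * n := Nat.mul_le_mul_right _ ((mul_cube_le_two_pow hl).trans (two_pow_log_le (by omega)))
    _ = n ^ 2 := (sq n).symm

/-- The binary logarithm of the ratio of the geometric progression on which the quality of rational
approximations of degree `intersectionDegree n` to the halfspace is tested. -/
def gridExponent (n : ℕ) : ℕ := n / (800 * intersectionDegree n)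

lemma intersectionDegree_mul_gridExponent_le (n : ℕ) :
    800 * (intersectionDegree n * gridExponent n) ≤ n := by
  rw [← mul_assoc]
  exact Nat.mul_div_le _ _

lemma lt_intersectionDegree_mul_gridExponent (hl : 100 ≤ Nat.log 2 n) :
    n < 800 * (intersectionDegree n * (gridExponent n + 1)) := by
  have hpos := intersectionDegree_pos hl
  rw [← mul_assoc]
  exact Nat.lt_mul_div_succ n (by omega)

lemma five_le_gridExponent (hl : 100 ≤ Nat.log 2 n) : 5 ≤ gridExponent n := by
  have hdl := intersectionDegree_mul_log_le hl
  have hle := Nat.mul_le_mul_left (intersectionDegree n) hl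
  have hpos := intersectionDegree_pos hl
  exact (Nat.le_div_iff_mul_le (by omega)).2 (by omega)

lemma gridExponent_pow_mul_pow_lt_two_pow (hl : 100 ≤ Nat.log 2 n) :
    4 * (2 * (2 ^ gridExponent n) ^ (100 * intersectionDegree n) + 1) ^ 2 *
      (n / 2 + 1) ^ (4 * intersectionDegree n) < 2 ^ (n / 2) := by
  have hdl := intersectionDegree_mul_log_le hl
  have hds := intersectionDegree_mul_gridExponent_le n
  have hld := Nat.mul_le_mul (intersectionDegree_pos hl) hl
  have hle := Nat.mul_le_mul_left (intersectionDegree n) hl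
  have hn : n < 2 ^ (Nat.log 2 n + 1) := Nat.lt_pow_succ_log_self one_lt_two n
  set d := intersectionDegree n
  set s := gridExponent n
  set l := Nat.log 2 n
  have hgrid : 2 * (2 ^ s) ^ (100 * d) + 1 ≤ 2 ^ (100 * (d * s) + 2) := by
    have hone : 1 ≤ 2 ^ (100 * (d * s)) := Nat.one_le_two_pow
    rw [← pow_mul, show s * (100 * d) = 100 * (d * s) by ring, pow_add]
    omega
  have hhalf : n / 2 + 1 ≤ 2 ^ (l + 1) := by omega
  calc 4 * (2 * (2 ^ s) ^ (100 * d) + 1) ^ 2 * (n / 2 + 1) ^ (4 * d)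
      ≤ 2 ^ 2 * (2 ^ (100 * (d * s) + 2)) ^ 2 * (2 ^ (l + 1)) ^ (4 * d) := by gcongr; norm_num
    _ = 2 ^ (2 + (100 * (d * s) + 2) * 2 + (4 * (d * l) + 4 * d)) := by
      rw [← pow_mul, ← pow_mul, ← pow_add, ← pow_add]
      ring_nf
    _ < 2 ^ (n / 2) := Nat.pow_lt_pow_right one_lt_two (by omega)

lemma forty_mul_intersectionDegree_le (hl : 100 ≤ Nat.log 2 n) :
    40 * intersectionDegree n ≤ Nat.log 2 n / 4 * 2 ^ (Nat.log 2 n / 2) := by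
  have hsq := intersectionDegree_sq_le n
  have hlt : n < 2 ^ (Nat.log 2 n + 1) := Nat.lt_pow_succ_log_self one_lt_two n
  set l := Nat.log 2 n
  have hn : n ≤ 4 * (2 ^ (l / 2)) ^ 2 := by
    rw [← pow_mul, show (4 : ℕ) = 2 ^ 2 from rfl, ← pow_add]
    exact hlt.le.trans (Nat.pow_le_pow_right two_pos (by omega))
  refine (Nat.pow_le_pow_iff_left two_ne_zero).1 (Nat.le_of_mul_le_mul_left (c := 2500) ?_
    (by norm_num))
  calc 2500 * (40 * intersectionDegree n) ^ 2 = (2000 * intersectionDegree n) ^ 2 := by ring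
    _ ≤ n * l := hsq
    _ ≤ 4 * (2 ^ (l / 2)) ^ 2 * (5 * (l / 4)) := Nat.mul_le_mul hn (by omega)
    _ = 20 * (l / 4) * (2 ^ (l / 2)) ^ 2 := by ring
    _ ≤ 2500 * (l / 4) ^ 2 * (2 ^ (l / 2)) ^ 2 :=
      Nat.mul_le_mul_right _ (by nlinarith [show 25 ≤ l / 4 by omega])
    _ = 2500 * (l / 4 * 2 ^ (l / 2)) ^ 2 := by ring

lemma four_hundred_mul_intersectionDegree_le (hl : 100 ≤ Nat.log 2 n) :
    400 * intersectionDegree n ≤ (2 * gridExponent n - 4) * (Nat.log 2 n / 4) := by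
  have hs := five_le_gridExponent hl
  have hd := intersectionDegree_pos hl
  have hn := (lt_intersectionDegree_mul_gridExponent hl).le
  have hsq := intersectionDegree_sq_le n
  set d := intersectionDegree n
  set s := gridExponent n
  set l := Nat.log 2 n
  have hmul : 800 * d * (5000 * d) ≤ 800 * d * (5 * ((2 * s - 4) * (l / 4))) := by
    calc 800 * d * (5000 * d) = (2000 * d) ^ 2 := by ring
      _ ≤ n * l := hsq
      _ ≤ 800 * (d * (s + 1)) * l := Nat.mul_le_mul_right _ hn
      _ = 800 * d * ((s + 1) * l) := by ring
      _ ≤ 800 * d * ((2 * s - 4) * (5 * (l / 4))) :=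
        Nat.mul_le_mul_left _ (Nat.mul_le_mul (by omega) (by omega))
      _ = 800 * d * (5 * ((2 * s - 4) * (l / 4))) := by ring
  have hle := Nat.le_of_mul_le_mul_left hmul (by omega)
  omega

lemma four_mul_sq_mul_exp_lt_one {d s J : ℕ} (hd : 0 < d) (hds : 400 * d ≤ (2 * s - 4) * J) :
    4 * (2 / 2 ^ s : ℝ) ^ 2 * Real.exp (100 * (2 * d : ℕ) / J) < 1 := by
  have hprod : 0 < (2 * s - 4) * J := by omega
  have hs : 4 < 2 * s := by have := Nat.pos_of_mul_pos_right hprod; omega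
  have hJ : (0 : ℝ) < J := Nat.cast_pos.2 (Nat.pos_of_mul_pos_left hprod)
  have hlt : (100 * (2 * d : ℕ) / J : ℝ) < (2 * s - 4 : ℕ) * Real.log 2 := by
    have hcast : (400 * d : ℝ) ≤ (2 * s - 4 : ℕ) * J := by exact_mod_cast hds
    have hdpos : (0 : ℝ) < d := Nat.cast_pos.2 hd
    rw [div_lt_iff₀ hJ]
    push_cast
    nlinarith [Real.log_two_gt_d9]
  have hpow : 4 * (2 / 2 ^ s : ℝ) ^ 2 * 2 ^ (2 * s - 4) = 1 := by
    have hsplit : (2 : ℝ) ^ s * 2 ^ s = 2 ^ (2 * s - 4) * 2 ^ 4 := by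
      rw [← pow_add, ← pow_add]
      congr 1
      omega
    rw [div_pow, sq (2 ^ s : ℝ), hsplit]
    field_simp
    norm_num
  calc 4 * (2 / 2 ^ s : ℝ) ^ 2 * Real.exp (100 * (2 * d : ℕ) / J)
      < 4 * (2 / 2 ^ s : ℝ) ^ 2 * Real.exp ((2 * s - 4 : ℕ) * Real.log 2) := by gcongr
    _ = 1 := by rw [Real.exp_nat_mul, Real.exp_log two_pos, hpow]

end Parameters

theorem exists_isHalfspace_intersectionDegree_lt {n : ℕ} (hl : 100 ≤ Nat.log 2 n) :
    ∃ h : (Fin n → Bool) → ℤˣ, IsHalfspace h ∧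
      intersectionDegree n < thresholdDegree (conjunction h (majority n)) := by
  set d := intersectionDegree n
  set s := gridExponent n
  set l := Nat.log 2 n
  have hd : 0 < d := intersectionDegree_pos hl
  have hB : 2 ≤ 2 ^ s := by
    have hs : 5 ≤ s := five_le_gridExponent hl
    simpa using Nat.pow_le_pow_right two_pos (show 1 ≤ s by omega)
  have haB : (2 : ℝ) ≤ 2 / 2 ^ s * (2 ^ s : ℕ) := by
    push_cast
    rw [div_mul_cancel₀ _ (by positivity)]
  obtain ⟨h, hh, hnot⟩ := exists_isHalfspace_not_hasRationalApprox hB (by omega : 0 < 100 * d)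
    le_rfl (gridExponent_pow_mul_pow_lt_two_pow hl) (by positivity) haB
  refine ⟨h, hh, lt_of_not_ge fun hle => ?_⟩
  have hsep := (hasRationalApprox_or_hasRationalSeparation hle (2 / 2 ^ s)).resolve_left hnot
  have hi : 20 * (2 * d) ≤ l / 4 * 2 ^ (l / 2) :=
    (Nat.mul_assoc 20 2 d).symm.trans_le (forty_mul_intersectionDegree_le hl)
  have hn : 2 ^ (l / 2 + l / 4) ≤ n / 2 := by
    rw [Nat.le_div_iff_mul_le two_pos, ← pow_succ]
    exact (Nat.pow_le_pow_right two_pos (by omega)).trans (two_pow_log_le (by omega))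
  exact (four_mul_sq_mul_exp_lt_one hd (four_hundred_mul_intersectionDegree_le hl)).not_ge
    (hsep.one_le_mul_exp (by omega) hi hn)

lemma exists_isHalfspace_thresholdDegree_conjunction_majority (n : ℕ) :
    ∃ h : (Fin n → Bool) → ℤˣ, IsHalfspace h ∧ (100 ≤ Nat.log 2 n →
      thresholdDegree (conjunction h (majority n)) = intersectionDegree n + 1) := by
  by_cases hl : 100 ≤ Nat.log 2 n
  · obtain ⟨h, hh, hlt⟩ := exists_isHalfspace_intersectionDegree_lt hl
    obtain ⟨h', hh', heq⟩ := exists_isHalfspace_thresholdDegree_eq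
      ((thresholdDegree_majority_le n).trans (Nat.le_add_left 1 _)) hh hlt
    exact ⟨h', hh', fun _ => heq⟩
  · exact ⟨fun _ => 1, ⟨0, -1, fun x => by simp⟩, fun h => absurd h hl⟩

lemma intersectionDegree_add_one_le_sqrt {n : ℕ} (hl : 100 ≤ Nat.log 2 n) :
    (intersectionDegree n + 1 : ℝ) ≤ √(n * Real.logb 2 n) := by
  have hpos := intersectionDegree_pos hl
  have hsq : (intersectionDegree n + 1) ^ 2 ≤ n * Nat.log 2 n :=
    (Nat.pow_le_pow_left (by omega) 2).trans (intersectionDegree_sq_le n)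
  refine Real.le_sqrt_of_sq_le ?_
  calc (intersectionDegree n + 1 : ℝ) ^ 2 ≤ n * Nat.log 2 n := by exact_mod_cast hsq
    _ ≤ n * Real.logb 2 n :=
      mul_le_mul_of_nonneg_left (Real.natLog_le_logb n 2) (Nat.cast_nonneg n)

lemma sqrt_le_intersectionDegree_add_one {n : ℕ} (hl : 100 ≤ Nat.log 2 n) :
    √(n * Real.logb 2 n) ≤ 4000 * (intersectionDegree n + 1) := by
  have hn : (0 : ℝ) < n := by
    exact_mod_cast (Nat.two_pow_pos _).trans_le (two_pow_log_le (by omega))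
  have hlog : Real.logb 2 n ≤ 2 * Nat.log 2 n := by
    have hfloor : Real.logb 2 n ≤ Nat.log 2 n + 1 := by
      rw [Real.logb_le_iff_le_rpow one_lt_two hn]
      exact_mod_cast (Nat.lt_pow_succ_log_self one_lt_two n).le
    have hone : (100 : ℝ) ≤ Nat.log 2 n := by exact_mod_cast hl
    linarith
  have hlt : (n * Nat.log 2 n : ℝ) ≤ (2000 * (intersectionDegree n + 1)) ^ 2 := by
    exact_mod_cast (lt_intersectionDegree_add_one_sq n).le
  refine Real.sqrt_le_iff.2 ⟨by positivity, ?_⟩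
  nlinarith [mul_le_mul_of_nonneg_left hlog hn.le, sq_nonneg (intersectionDegree n + 1 : ℝ)]

theorem theorem6p3 :
    ∃ h : (n : ℕ) → (Fin n → Bool) → ℤˣ,
      (∀ n : ℕ, IsHalfspace (h n)) ∧
      (fun n : ℕ => (thresholdDegree (conjunction (h n) (majority n)) : ℝ))
        =Θ[atTop] (fun n : ℕ => Real.sqrt ((n : ℝ) * Real.logb 2 (n : ℝ))) := by
  choose h hh hdeg using exists_isHalfspace_thresholdDegree_conjunction_majority
  have hlarge : ∀ᶠ n : ℕ in atTop, 100 ≤ Nat.log 2 n :=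
    (eventually_ge_atTop (2 ^ 100)).mono fun n hn => Nat.le_log_of_pow_le one_lt_two hn
  refine ⟨h, hh, IsBigO.of_bound 1 ?_, IsBigO.of_bound 4000 ?_⟩
  · filter_upwards [hlarge] with n hl
    rw [hdeg n hl, Real.norm_of_nonneg (Nat.cast_nonneg _),
      Real.norm_of_nonneg (Real.sqrt_nonneg _), one_mul, Nat.cast_succ]
    exact intersectionDegree_add_one_le_sqrt hl
  · filter_upwards [hlarge] with n hl
    rw [hdeg n hl, Real.norm_of_nonneg (Nat.cast_nonneg _),
      Real.norm_of_nonneg (Real.sqrt_nonneg _), Nat.cast_succ]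
    exact sqrt_le_intersectionDegree_add_one hl
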